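/- Let $B_2'$ be the commutative ring generated by $e,e',a,a',b,b'$, by $v_n$ $(n\ge 1)$, and by $g(\omega,c,\mu),h(\omega,c,\mu)$ $(\omega\in\mathbb Z,\ c,\mu\in\mathbb N=\{0,1,2,\dots\})$, subject to the following relations for all $\omega\in\mathbb Z$ and $c,\mu\in\mathbb N$ (no relation involves $e,e'$): - $g(\omega,c,\mu)\,h(\omega,c,\mu)=1$; - $a'b=ab'=ab,\quad aa=aa',\quad bb=bb'$; - (Reidemeister I) $g(\omega+1,c+1,\mu)\,(av_{n+1}+bv_n)=g(\omega,c,\mu)\,v_n$ and $g(\omega-1,c+1,\mu)\,(bv_{n+1}+av_n)=g(\omega,c,\mu)\,v_n$ for $n\ge 1$; - (Reidemeister II) $g(\omega,c+2,\mu)\,\{a'(av_{n-1}+bv_n)+b'(a'v_n+b'v_{n-1})\}=g(\omega,c,\mu)\,v_n$ for $n\ge 2$. All link diagrams are nonempty diagrams in the plane. For a crossing of an unoriented link diagram $H$, let $I$ be the diagram obtained by the smoothing that joins the two regions swept by the overcrossing strand when it is turned counterclockwise, and let $II$ be the diagram obtained by the other smoothing. (At a positive crossing, $I$ is the smoothing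 compatible with the orientation.) Theorem. (1) There is exactly one function $f$ from unoriented link diagrams to $B_2'$ that takes the value $v_n$ on every diagram without crossings and with $n$ components, and that satisfies at every crossing of every diagram $$f(H)=a f(I)+b f(II)$$ if the two strands at the crossing belong to the same link component, and $$f(H)=a' f(I)+b' f(II)$$ otherwise. This $f$ is a diagram invariant: it depends only on the diagram up to planar equivalence. (2) For an oriented link diagram $D$ with writhe $\omega$, crossing number $c$ and $\mu$ components, put $F(D)=g(\omega,c,\mu)\,f(D)$. Then $F$ is a link invariant, that is, it is invariant under planar equivalence and all Reidemeister moves of oriented diagrams. (3) There is a ring homomorphism $\varphi:B_2'\to\mathbb Z[t^{\pm 1/4}]$ with $\varphi(a)=\varphi(a')=t^{-1/4}$, $\varphi(b)=\varphi(b')=t^{1/4}$ and $\varphi(g(\omega,c,\mu))=(-t^{3/4})^{\omega}$ such that $\varphi(F(D))$ is the Jones polynomial $V$: it is a link invariant, it equals $1$ on crossingless diagrams with one component, and $t^{-1}V(L_+)-tV(L_-)=(t^{1/2}-t^{-1/2})V(L_0)$ for all oriented skein triples. -/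

import Mathlib

/-! ## The coefficient ring -/

/-- Generators of the coefficient ring; `w`, `c`, `μ` range over `ℤ`, `ℕ`, `ℕ`, and `v n` over `n ≥ 1`. -/
inductive SkeinGen : Type
  | e | e' | a | a' | b | b'
  | v (n : ℕ+)
  | g (w : ℤ) (c μ : ℕ)
  | h (w : ℤ) (c μ : ℕ)

namespace SkeinGen

/-- A generator as a polynomial. -/
noncomputable abbrev poly (x : SkeinGen) : MvPolynomial SkeinGen ℤ := MvPolynomial.X x

/-- The defining relations. The generators `e` and `e'` occur in no relation. In the Reidemeister II
relation `v (n + 1)` is the value on the right and `v n` its predecessor, so that all indices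
are at least one. -/
inductive Rel : MvPolynomial SkeinGen ℤ → MvPolynomial SkeinGen ℤ → Prop
  | g_mul_h (w : ℤ) (c μ : ℕ) : Rel (poly (g w c μ) * poly (h w c μ)) 1
  | a'_b : Rel (poly a' * poly b) (poly a * poly b)
  | a_b' : Rel (poly a * poly b') (poly a * poly b)
  | a_a' : Rel (poly a * poly a) (poly a * poly a')
  | b_b' : Rel (poly b * poly b) (poly b * poly b')
  | reidemeisterI_pos (w : ℤ) (c μ : ℕ) (n : ℕ+) :
      Rel (poly (g (w + 1) (c + 1) μ) * (poly a * poly (v (n + 1)) + poly b * poly (v n)))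
        (poly (g w c μ) * poly (v n))
  | reidemeisterI_neg (w : ℤ) (c μ : ℕ) (n : ℕ+) :
      Rel (poly (g (w - 1) (c + 1) μ) * (poly b * poly (v (n + 1)) + poly a * poly (v n)))
        (poly (g w c μ) * poly (v n))
  | reidemeisterII (w : ℤ) (c μ : ℕ) (n : ℕ+) :
      Rel (poly (g w (c + 2) μ) *
          (poly a' * (poly a * poly (v n) + poly b * poly (v (n + 1))) +
            poly b' * (poly a' * poly (v (n + 1)) + poly b' * poly (v n))))
        (poly (g w c μ) * poly (v (n + 1)))

end SkeinGen

/-- The commutative ring `B₂'`: generated by `SkeinGen` subject to `SkeinGen.Rel`. -/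
abbrev SkeinRing : Type := RingQuot SkeinGen.Rel

/-- The class of a generator in `B₂'`. -/
noncomputable def SkeinRing.gen (x : SkeinGen) : SkeinRing :=
  RingQuot.mkRingHom SkeinGen.Rel (MvPolynomial.X x)

/-! ## Link diagrams

A diagram is recorded as a plane graph with crossings as 4-valent vertices, and with some further
2-valent vertices (marks) on its arcs, so that circles without crossings have vertices too. The graph
is given by its half-edges (darts), the pairing of the two halves of each edge, and the
counterclockwise cyclic order of the darts at each vertex. -/

/-- The darts of a graph with crossings `X` and marks `M`. The four darts `0, 1, 2, 3` at a crossing are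
in counterclockwise order; the overcrossing strand consists of `0` and `2`, the undercrossing
strand of `1` and `3`. -/
abbrev Dart (X M : Type) : Type := (X × ZMod 4) ⊕ (M × ZMod 2)

namespace Dart

variable {X M X' M' : Type}

/-- The next dart at the same vertex, counterclockwise. -/
def rot : Dart X M → Dart X M
  | .inl (x, i) => .inl (x, i + 1)
  | .inr (m, j) => .inr (m, j + 1)

/-- The opposite dart: the other half, at the same vertex, of the strand through that vertex. -/
def opp : Dart X M → Dart X M
  | .inl (x, i) => .inl (x, i + 2)
  | .inr (m, j) => .inr (m, j + 1)

/-- The dart belongs to the overcrossing strand of a crossing. -/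
def IsOver : Dart X M → Prop
  | .inl (_, i) => i = 0 ∨ i = 2
  | .inr _ => False

/-- Renaming of crossings and marks. -/
def map (φ : X → X') (ψ : M → M') : Dart X M → Dart X' M'
  | .inl (x, i) => .inl (φ x, i)
  | .inr (m, j) => .inr (ψ m, j)

end Dart

/-- A diagram on a closed oriented surface. -/
structure SurfaceDiagram : Type 1 where
  Crossing : Type
  Mark : Type
  finite_crossing : Finite Crossing
  finite_mark : Finite Mark
  /-- The other half of the edge of a dart. -/
  edge : Dart Crossing Mark → Dart Crossing Mark
  edge_edge : ∀ d, edge (edge d) = d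
  edge_ne : ∀ d, edge d ≠ d

namespace SurfaceDiagram

variable (D : SurfaceDiagram)

/-- The edges of the graph. (`Quot` divides by the equivalence relation that is generated.) -/
def Edge : Type := Quot fun d d' : Dart D.Crossing D.Mark => d' = D.edge d

/-- The faces of the rotation system. -/
def Face : Type := Quot fun d d' : Dart D.Crossing D.Mark => d' = (D.edge d).rot

/-- The connected components of the graph (not of the link). -/
def Piece : Type := Quot fun d d' : Dart D.Crossing D.Mark => d' = D.edge d ∨ d' = d.rot

/-- The components of the link: one goes along edges and straight on at vertices. -/
def Component : Type := Quot fun d d' : Dart D.Crossing D.Mark => d' = D.edge d ∨ d' = d.opp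

/-- The link component through a dart. -/
def component (d : Dart D.Crossing D.Mark) : D.Component := Quot.mk _ d

/-- The number of crossings. -/
noncomputable def crossingNumber : ℕ := Nat.card D.Crossing

/-- The number of components of the link. -/
noncomputable def componentNumber : ℕ := Nat.card D.Component

/-- All connected components of the graph have genus zero: `V - E + F = 2 C`. -/
def IsPlanar : Prop :=
  Nat.card D.Crossing + Nat.card D.Mark + Nat.card D.Face = Nat.card D.Edge + 2 * Nat.card D.Piece

end SurfaceDiagram

/-- A nonempty unoriented link diagram in the plane. -/
structure LinkDiagram : Type 1 extends SurfaceDiagram where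
  planar : toSurfaceDiagram.IsPlanar
  nonempty : Nonempty (Dart Crossing Mark)

/-- An oriented link diagram: `out d` says that the strand leaves the vertex of `d` along `d`. -/
structure OrientedDiagram : Type 1 extends LinkDiagram where
  out : Dart Crossing Mark → Bool
  out_edge : ∀ d, out (edge d) = !out d
  out_opp : ∀ d, out d.opp = !out d

namespace OrientedDiagram

variable (D : OrientedDiagram)

/-- The sign of a crossing: it is positive if the direction of the overcrossing strand becomes that of the
undercrossing strand by a counterclockwise quarter turn. -/
def sign (x : D.Crossing) : ℤ := if D.out (.inl (x, 0)) = D.out (.inl (x, 1)) then 1 else -1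

/-- The writhe. -/
noncomputable def writhe : ℤ := ∑ᶠ x : D.Crossing, D.sign x

end OrientedDiagram

/-! ## Planar equivalence -/

/-- An isomorphism of diagrams, respecting edges, the cyclic order at vertices, and over and under. -/
structure DiagramIso (D D' : SurfaceDiagram) where
  dart : Dart D.Crossing D.Mark ≃ Dart D'.Crossing D'.Mark
  edge : ∀ d, dart (D.edge d) = D'.edge (dart d)
  rot : ∀ d, dart d.rot = (dart d).rot
  isOver : ∀ d, (dart d).IsOver ↔ d.IsOver

/-- `D'` arises from `D` by a new mark on the edge of the dart `base`. -/
structure Subdivision (D D' : SurfaceDiagram) where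
  crossing : D.Crossing ≃ D'.Crossing
  mark : Option D.Mark ≃ D'.Mark
  base : Dart D.Crossing D.Mark
  edge_base : D'.edge (base.map crossing (mark ∘ some)) = .inr (mark none, 0)
  edge_edge_base : D'.edge ((D.edge base).map crossing (mark ∘ some)) = .inr (mark none, 1)
  edge_other : ∀ d, d ≠ base → d ≠ D.edge base →
    D'.edge (d.map crossing (mark ∘ some)) = (D.edge d).map crossing (mark ∘ some)

/-! ## Local changes of diagrams -/

/-- A part of a diagram inside a disc: its vertices, its `n` darts that leave the disc, and the edges
inside the disc, each listed as a pair of darts. -/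
structure LocalPicture (n : ℕ) where
  Crossing : Type
  Mark : Type
  ends : Fin n → Dart Crossing Mark
  inner : List (Dart Crossing Mark × Dart Crossing Mark)

/-- An occurrence of the local picture `P` in `D`, where `X` and `M` are the crossings and marks
outside. -/
structure Placement (D : SurfaceDiagram) {n : ℕ} (P : LocalPicture n) (X M : Type) where
  crossing : X ⊕ P.Crossing ≃ D.Crossing
  mark : M ⊕ P.Mark ≃ D.Mark
  inner : ∀ q ∈ P.inner,
    D.edge (q.1.map (crossing ∘ Sum.inr) (mark ∘ Sum.inr)) =
      q.2.map (crossing ∘ Sum.inr) (mark ∘ Sum.inr)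

namespace Placement

variable {D D' : SurfaceDiagram} {n : ℕ} {P P' : LocalPicture n} {X M : Type}

/-- The darts of `D` that are visible from outside: those at outside vertices, and the ends of `P`. -/
def port (A : Placement D P X M) : Dart X M ⊕ Fin n → Dart D.Crossing D.Mark
  | .inl d => d.map (A.crossing ∘ Sum.inl) (A.mark ∘ Sum.inl)
  | .inr i => (P.ends i).map (A.crossing ∘ Sum.inr) (A.mark ∘ Sum.inr)

/-- The two diagrams are the same outside the local pictures. -/
def SameOutside (A : Placement D P X M) (B : Placement D' P' X M) : Prop :=
  ∀ u v, D.edge (A.port u) = A.port v ↔ D'.edge (B.port u) = B.port v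

end Placement

namespace LocalPicture

/-- A crossing whose overcrossing strand joins the ends `0` and `2`. The ends of this picture and of the
next three are in counterclockwise order. -/
def crossing : LocalPicture 4 where
  Crossing := Unit
  Mark := Empty
  ends := ![.inl ((), 0), .inl ((), 1), .inl ((), 2), .inl ((), 3)]
  inner := []

/-- The crossing with over and under exchanged. -/
def switched : LocalPicture 4 where
  Crossing := Unit
  Mark := Empty
  ends := ![.inl ((), 3), .inl ((), 0), .inl ((), 1), .inl ((), 2)]
  inner := []

/-- The smoothing of `crossing` that joins the two regions swept by the overcrossing strand when
it turns counterclockwise: the arcs join the ends `1`, `2` and the ends `3`, `0`. -/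
def smoothI : LocalPicture 4 where
  Crossing := Empty
  Mark := Bool
  ends := ![.inr (true, 1), .inr (false, 0), .inr (false, 1), .inr (true, 0)]
  inner := []

/-- The other smoothing: the arcs join the ends `0`, `1` and the ends `2`, `3`. -/
def smoothII : LocalPicture 4 where
  Crossing := Empty
  Mark := Bool
  ends := ![.inr (false, 0), .inr (false, 1), .inr (true, 0), .inr (true, 1)]
  inner := []

/-- One arc. -/
def arc : LocalPicture 2 where
  Crossing := Empty
  Mark := Unit
  ends := ![.inr ((), 0), .inr ((), 1)]
  inner := []

/-- An arc with a kink: the consecutive darts `i` and `i + 1` of one crossing are joined. -/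
def kink (i : ZMod 4) : LocalPicture 2 where
  Crossing := Unit
  Mark := Empty
  ends := ![.inl ((), i + 2), .inl ((), i + 3)]
  inner := [(.inl ((), i), .inl ((), i + 1))]

/-- Two parallel arcs, with ends `0`, `1` and `2`, `3`. -/
def twoArcs : LocalPicture 4 where
  Crossing := Empty
  Mark := Bool
  ends := ![.inr (false, 0), .inr (false, 1), .inr (true, 0), .inr (true, 1)]
  inner := []

/-- The first arc pushed over the second one. At both crossings the darts `0, 1, 2, 3` point north,
west, south, east; the second arc runs along a horizontal line, the first one comes from above, dips
below this line at the crossing `false`, and returns at the crossing `true` further east. -/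
def bigon : LocalPicture 4 where
  Crossing := Bool
  Mark := Empty
  ends := ![.inl (false, 0), .inl (true, 0), .inl (false, 1), .inl (true, 3)]
  inner := [(.inl (false, 2), .inl (true, 2)), (.inl (false, 3), .inl (true, 1))]

/-- The crossings of a top, a middle and a bottom strand with each other. -/
inductive Triple : Type
  | topMiddle | topBottom | middleBottom

open Triple

/-- The middle strand runs from southwest to northeast, the bottom strand from northwest to southeast, and the
horizontal top strand passes south of their crossing. The dart `0` points east at the crossings on the
top strand, and northeast at the third crossing. The ends are those in the west, southwest, southeast,
east, northeast, northwest. For `s = 1` this is the picture described, for `s = -1` it is its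
reflection in a vertical line, over and under being kept. -/
def triangle (s : ℤˣ) : LocalPicture 6 where
  Crossing := Triple
  Mark := Empty
  ends := ![.inl (topMiddle, (s : ℤ) * 2), .inl (topMiddle, (s : ℤ) * 3),
    .inl (topBottom, (s : ℤ) * 3), .inl (topBottom, (s : ℤ) * 0),
    .inl (middleBottom, (s : ℤ) * 0), .inl (middleBottom, (s : ℤ) * 1)]
  inner := [(.inl (topMiddle, (s : ℤ) * 0), .inl (topBottom, (s : ℤ) * 2)),
    (.inl (topMiddle, (s : ℤ) * 1), .inl (middleBottom, (s : ℤ) * 2)),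
    (.inl (topBottom, (s : ℤ) * 1), .inl (middleBottom, (s : ℤ) * 3))]

/-- As `triangle s`, but the top strand passes north of the crossing of the other two. -/
def triangleMoved (s : ℤˣ) : LocalPicture 6 where
  Crossing := Triple
  Mark := Empty
  ends := ![.inl (topBottom, (s : ℤ) * 2), .inl (middleBottom, (s : ℤ) * 2),
    .inl (middleBottom, (s : ℤ) * 3), .inl (topMiddle, (s : ℤ) * 0),
    .inl (topMiddle, (s : ℤ) * 1), .inl (topBottom, (s : ℤ) * 1)]
  inner := [(.inl (topBottom, (s : ℤ) * 0), .inl (topMiddle, (s : ℤ) * 2)),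
    (.inl (topMiddle, (s : ℤ) * 3), .inl (middleBottom, (s : ℤ) * 0)),
    (.inl (topBottom, (s : ℤ) * 3), .inl (middleBottom, (s : ℤ) * 1))]

end LocalPicture

open LocalPicture in
/-- The three Reidemeister moves. -/
inductive ReidemeisterMove : {n : ℕ} → LocalPicture n → LocalPicture n → Prop
  | one (i : ZMod 4) : ReidemeisterMove arc (kink i)
  | two : ReidemeisterMove twoArcs bigon
  | three (s : ℤˣ) : ReidemeisterMove (triangle s) (triangleMoved s)

/-- Moves between oriented diagrams that represent the same oriented link. -/
inductive OrientedDiagram.Move : OrientedDiagram → OrientedDiagram → Prop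
  | iso (D D' : OrientedDiagram) (φ : DiagramIso D.toSurfaceDiagram D'.toSurfaceDiagram)
      (hout : ∀ d, D'.out (φ.dart d) = D.out d) : Move D D'
  | subdivision (D D' : OrientedDiagram) (S : Subdivision D.toSurfaceDiagram D'.toSurfaceDiagram)
      (hout : ∀ d, D'.out (d.map S.crossing (S.mark ∘ some)) = D.out d) : Move D D'
  | reidemeister (D D' : OrientedDiagram) {n : ℕ} (P P' : LocalPicture n)
      (hmove : ReidemeisterMove P P') (X M : Type)
      (A : Placement D.toSurfaceDiagram P X M) (B : Placement D'.toSurfaceDiagram P' X M)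
      (hsame : A.SameOutside B) (hout : ∀ u, D.out (A.port u) = D'.out (B.port u)) : Move D D'

/-! ## Invariants -/

/-- A function of unoriented diagrams that depends only on the diagram up to planar equivalence. -/
def IsDiagramInvariant {R : Type*} (f : LinkDiagram → R) : Prop :=
  ∀ D D' : LinkDiagram,
    (Nonempty (DiagramIso D.toSurfaceDiagram D'.toSurfaceDiagram) ∨
      Nonempty (Subdivision D.toSurfaceDiagram D'.toSurfaceDiagram)) → f D = f D'

/-- A function of oriented diagrams that depends only on the oriented link. -/
def IsLinkInvariant {R : Type*} (F : OrientedDiagram → R) : Prop :=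
  ∀ D D' : OrientedDiagram, D.Move D' → F D = F D'

open SkeinGen SkeinRing in
/-- The skein relations, at every crossing of every diagram `H` with smoothings `I` and `II`:
`H = a I + b II` if the two strands are from the same link component, and `H = a' I + b' II`
otherwise. -/
def SatisfiesSkeinRelations (f : LinkDiagram → SkeinRing) : Prop :=
  ∀ (H I II : LinkDiagram) (X M : Type)
    (A : Placement H.toSurfaceDiagram LocalPicture.crossing X M)
    (B : Placement I.toSurfaceDiagram LocalPicture.smoothI X M)
    (C : Placement II.toSurfaceDiagram LocalPicture.smoothII X M),
    A.SameOutside B → A.SameOutside C →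
    (H.component (A.port (.inr 0)) = H.component (A.port (.inr 1)) →
      f H = gen a * f I + gen b * f II) ∧
    (H.component (A.port (.inr 0)) ≠ H.component (A.port (.inr 1)) →
      f H = gen a' * f I + gen b' * f II)

/-- The value on a crossingless diagram with `n` components is `v n`. -/
def TakesTrivialValues (f : LinkDiagram → SkeinRing) : Prop :=
  ∀ (D : LinkDiagram) (n : ℕ+), D.crossingNumber = 0 → D.componentNumber = n →
    f D = SkeinRing.gen (SkeinGen.v n)

/-- `F(D) = g(ω, c, μ) f(D)`, with the writhe `ω`, crossing number `c` and number `μ` of components. -/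
noncomputable def normalised (f : LinkDiagram → SkeinRing) (D : OrientedDiagram) : SkeinRing :=
  SkeinRing.gen (SkeinGen.g D.writhe D.crossingNumber D.componentNumber) * f D.toLinkDiagram

open LaurentPolynomial in
/-- `V` is the Jones polynomial, as a Laurent polynomial in `T 1 = t ^ (1 / 4)`: the link invariant
with value `1` on the unknot and `t⁻¹ V(L₊) - t V(L₋) = (t ^ (1 / 2) - t ^ (-1 / 2)) V(L₀)`.
In the skein triple the orientations agree at the four ends, and an orientation of `L₀` exists only if
the crossing of `L₊` is positive. -/
def IsJonesPolynomial (V : OrientedDiagram → LaurentPolynomial ℤ) : Prop :=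
  IsLinkInvariant V ∧
  (∀ D : OrientedDiagram, D.crossingNumber = 0 → D.componentNumber = 1 → V D = 1) ∧
  ∀ (Lpos Lneg Lzero : OrientedDiagram) (X M : Type)
    (A : Placement Lpos.toSurfaceDiagram LocalPicture.crossing X M)
    (B : Placement Lneg.toSurfaceDiagram LocalPicture.switched X M)
    (C : Placement Lzero.toSurfaceDiagram LocalPicture.smoothI X M),
    A.SameOutside B → A.SameOutside C →
    (∀ u, Lpos.out (A.port u) = Lneg.out (B.port u)) →
    (∀ u, Lpos.out (A.port u) = Lzero.out (C.port u)) →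
    T (-4) * V Lpos - T 4 * V Lneg = (T 2 - T (-2)) * V Lzero

/-!
The relations make the primed and the unprimed coefficients agree on all values that the invariant
takes. By the first relation of type Reidemeister I, `v n` is a multiple of
`a * v (n + 1) + b * v n`, and this combination is annihilated by `a' - a` and by `b' - b`; hence
`a' * v n = a * v n` and `b' * v n = b * v n` (`gen_a'_mul_gen_v`, `gen_b'_mul_gen_v`). So the
function `f` is the Kauffman state sum `skeinBracket`: the sum over all states of the products of
`a` and `b`, times `v k` for the `k` closed curves of the state. The two skein relations coincide on
its values, and existence follows.

Uniqueness is an induction on the number of crossings, but the induction needs both smoothings of a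
planar diagram to be planar diagrams (`LinkDiagram.exists_smoothings`). Here planarity is an
equation for the Euler characteristic of a rotation system. Linear algebra shows that it is
equivalent to the vanishing of the first homology with coefficients in `ZMod 2`
(`euler_iff_isAcyclic`), and this condition survives the splitting of a vertex: there are more
conditions on cycles, and they are just what is needed for functions on the old faces to be
functions on the new ones (`IsAcyclic.split`).

The same criterion, applied to the sum of all edges, colours the faces of a planar diagram like a
checkerboard (`SurfaceDiagram.IsPlanar.exists_checkerboard`). A saddle move that is compatible with
a checkerboard colouring either splits one closed curve or joins two (`loopCount_saddle`). In a
Reidemeister II move, three of the four states of the new crossings differ from the original arcs by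
such a saddle move. If it lowers the number of curves, then the invariance is the relation of type
Reidemeister II; if it raises the number, then the invariance follows from two relations of type
Reidemeister I with opposite signs (`reidemeisterII`, `reidemeisterII_of_reidemeisterI`,
`loopValue_bigon`). Invariance under Reidemeister III follows from this as for the Kauffman bracket:
one smoothing of the crossing of the two lower strands gives the same strands on both sides, the
other one gives two diagrams that are related by Reidemeister II moves to a common third one
(`LocalPicture.bracket_triangle`).

The geometric pictures enter only through the way in which the strands of a local picture connect
its ends, and through the number of its closed strands (`Placement.loopCount_eq`); for the pictures
of the Reidemeister moves both can be computed. For the Jones polynomial, `v n` is sent to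
`(-t ^ (1 / 2) - t ^ (-1 / 2)) ^ (n - 1)`, and the skein relation eliminates the smoothing against
the orientation from the state sums of `L₊` and `L₋`.
-/

/-! ### Planarity and homology with coefficients in `ZMod 2` -/

section Homology

variable {T : Type*}

/-- The functions with values in `ZMod 2` that are constant along a relation. -/
def invariantFunctions (R : T → T → Prop) : Submodule (ZMod 2) (T → ZMod 2) where
  carrier := {z | ∀ x y, R x y → z x = z y}
  add_mem' hz hw x y h := by simp [hz x y h, hw x y h]
  zero_mem' _ _ _ := rfl
  smul_mem' t z hz x y h := by simp [hz x y h]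

theorem finrank_invariantFunctions [Finite T] (R : T → T → Prop) :
    Module.finrank (ZMod 2) (invariantFunctions R) = Nat.card (Quot R) := by
  have := Fintype.ofFinite (Quot R)
  let φ : (Quot R → ZMod 2) ≃ₗ[ZMod 2] invariantFunctions R :=
    { toFun := fun y => ⟨fun x => y (Quot.mk R x), fun _ _ h => congrArg y (Quot.sound h)⟩
      map_add' := fun _ _ => rfl
      map_smul' := fun _ _ => rfl
      invFun := fun z => Quot.lift z.1 z.2
      left_inv := fun y => by ext q; induction q using Quot.ind; rfl
      right_inv := fun z => rfl }
  rw [← φ.finrank_eq, Module.finrank_fintype_fun_eq_card, Nat.card_eq_fintype_card]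

/-- The vanishing of the first homology, with coefficients in `ZMod 2`, of the closed surface that a
rotation system describes; `e` is the pairing of the darts to edges and `r` the rotation at the
vertices. A 1-chain `z` is a function on edges; it is a cycle if it is orthogonal to all functions
on vertices, and a boundary if it comes from a function `c` on faces. Here functions on edges,
vertices and faces are recorded as functions on darts. -/
def IsAcyclic [Fintype T] (e r : T → T) : Prop :=
  ∀ z : T → ZMod 2, (∀ d, z (e d) = z d) →
    (∀ y : T → ZMod 2, (∀ d, y (r d) = y d) → ∑ d, y d * z d = 0) →
    ∃ c : T → ZMod 2, (∀ d, c (r (e d)) = c d) ∧ ∀ d, z d = c d + c (e d)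

theorem mem_invariantFunctions_apply {f : T → T} {z : T → ZMod 2} :
    z ∈ invariantFunctions (fun d d' => d' = f d) ↔ ∀ d, z (f d) = z d :=
  ⟨fun h d => (h d _ rfl).symm, fun h x y hy => by rw [hy, h]⟩

theorem mem_invariantFunctions_or {f g : T → T} {z : T → ZMod 2} :
    z ∈ invariantFunctions (fun d d' => d' = f d ∨ d' = g d) ↔
      (∀ d, z (f d) = z d) ∧ ∀ d, z (g d) = z d :=
  ⟨fun h => ⟨fun d => (h d _ (.inl rfl)).symm, fun d => (h d _ (.inr rfl)).symm⟩,
    fun h x y hy => by rcases hy with rfl | rfl <;> simp [h.1, h.2]⟩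

/-- The kernel of a map on `P`, described as a subspace `Q` of the ambient space. -/
theorem finrank_ker_eq_of_mem {K V W : Type*} [Field K] [AddCommGroup V] [Module K V]
    [AddCommGroup W] [Module K W] {P Q : Submodule K V} (f : P →ₗ[K] W) (hQP : Q ≤ P)
    (h : ∀ z : P, f z = 0 ↔ (z : V) ∈ Q) :
    Module.finrank K (LinearMap.ker f) = Module.finrank K Q := by
  have : (LinearMap.ker f).map P.subtype = Q := by
    ext x
    simp only [Submodule.mem_map, LinearMap.mem_ker, Submodule.subtype_apply, Subtype.exists,
      exists_and_right, exists_eq_right]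
    exact ⟨fun ⟨hx, hf⟩ => (h ⟨x, hx⟩).1 hf, fun hx => ⟨hQP hx, (h ⟨x, hQP hx⟩).2 hx⟩⟩
  rw [← this, Submodule.finrank_map_subtype_eq]

theorem LinearMap.finrank_range_flip {K V W : Type*} [Field K] [AddCommGroup V] [Module K V]
    [AddCommGroup W] [Module K W] [FiniteDimensional K V] [FiniteDimensional K W]
    (B : V →ₗ[K] W →ₗ[K] K) :
    Module.finrank K (LinearMap.range B.flip) = Module.finrank K (LinearMap.range B) := by
  have h : B.flip = B.dualMap ∘ₗ (Module.evalEquiv K W).toLinearMap := by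
    ext w v; rfl
  rw [h, LinearMap.range_comp, LinearEquiv.range, Submodule.map_top,
    LinearMap.finrank_range_dualMap_eq_finrank_range]

/-- Over `ZMod 2`, the sum of a function that is invariant under a fixed-point free involution
vanishes. -/
theorem sum_eq_zero_of_involution [Fintype T] {e : T → T} (he : ∀ d, e (e d) = d)
    (hne : ∀ d, e d ≠ d) {z : T → ZMod 2} (hz : ∀ d, z (e d) = z d) : ∑ d, z d = 0 :=
  Finset.sum_involution (fun d _ => e d) (fun d _ => by rw [hz]; exact CharTwo.add_self_eq_zero _)
    (fun d _ _ => hne d) (fun _ _ => Finset.mem_univ _) (fun d _ => he d)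

/-- The Euler characteristic has the value of a union of spheres exactly when the first
homology vanishes: the left side counts the dimensions of cycles and of boundaries. -/
theorem euler_iff_isAcyclic [Fintype T] (e r : T → T) (he : ∀ d, e (e d) = d)
    (hne : ∀ d, e d ≠ d) (hr : Function.Bijective r) :
    Nat.card (Quot fun d d' => d' = r d) + Nat.card (Quot fun d d' => d' = r (e d)) =
        Nat.card (Quot fun d d' => d' = e d) + 2 * Nat.card (Quot fun d d' => d' = e d ∨ d' = r d) ↔
      IsAcyclic e r := by
  classical
  simp only [← finrank_invariantFunctions]
  set Re := invariantFunctions fun d d' : T => d' = e d with hRe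
  set Rr := invariantFunctions fun d d' : T => d' = r d with hRr
  set Rf := invariantFunctions fun d d' : T => d' = r (e d) with hRf
  set Rp := invariantFunctions fun d d' : T => d' = e d ∨ d' = r d with hRp
  have two (x : ZMod 2) : x + x = 0 := CharTwo.add_self_eq_zero x
  have hpe : Rp ≤ Re := fun z hz => mem_invariantFunctions_apply.2 (mem_invariantFunctions_or.1 hz).1
  have hpr : Rp ≤ Rr := fun z hz => mem_invariantFunctions_apply.2 (mem_invariantFunctions_or.1 hz).2
  have hpf : Rp ≤ Rf := fun z hz => mem_invariantFunctions_apply.2 fun d => by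
    have := mem_invariantFunctions_or.1 hz
    rw [this.2, this.1]
  -- the boundary map from functions on faces to functions on edges
  let S : Rf →ₗ[ZMod 2] Re :=
    { toFun := fun c => ⟨fun d => c.1 d + c.1 (e d), mem_invariantFunctions_apply.2 fun d => by
        rw [he, add_comm]⟩
      map_add' := fun c c' => by ext d; simp; ring
      map_smul' := fun t c => by ext d; simp; ring }
  -- the pairing of functions on edges with functions on vertices
  let B : Re →ₗ[ZMod 2] Rr →ₗ[ZMod 2] ZMod 2 :=
    LinearMap.mk₂ (ZMod 2) (fun z y => ∑ d, y.1 d * z.1 d)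
      (fun _ _ _ => by simp [mul_add, Finset.sum_add_distrib])
      (fun _ _ _ => by simp [Finset.mul_sum, mul_left_comm])
      (fun _ _ _ => by simp [add_mul, Finset.sum_add_distrib])
      (fun _ _ _ => by simp [Finset.mul_sum, mul_assoc])
  have hB (z : Re) (y : Rr) : B z y = ∑ d, y.1 d * z.1 d := rfl
  have hS (c : Rf) (d : T) : (S c).1 d = c.1 d + c.1 (e d) := rfl
  -- the kernel of the boundary map consists of the functions on connected components
  have hkS : Module.finrank (ZMod 2) (LinearMap.ker S) = Module.finrank (ZMod 2) Rp := by
    refine finrank_ker_eq_of_mem S hpf fun c => ?_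
    have hc := mem_invariantFunctions_apply.1 c.2
    constructor
    · intro h
      have h' : ∀ d, c.1 (e d) = c.1 d := fun d => by
        have : c.1 d + c.1 (e d) = 0 := by rw [← hS, h]; rfl
        exact (CharTwo.add_eq_zero.1 this).symm
      refine mem_invariantFunctions_or.2 ⟨h', fun d => ?_⟩
      have := hc (e d)
      rw [he] at this
      rw [this, h']
    · intro h
      ext d
      rw [hS, (mem_invariantFunctions_or.1 h).1, two]; rfl
  -- and so does the kernel of the coboundary map, the transpose of `B`
  have hkB : Module.finrank (ZMod 2) (LinearMap.ker B.flip) = Module.finrank (ZMod 2) Rp := by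
    refine finrank_ker_eq_of_mem B.flip hpr fun y => ?_
    constructor
    · intro h
      refine mem_invariantFunctions_or.2 ⟨fun d => ?_, mem_invariantFunctions_apply.1 y.2⟩
      -- test against the indicator function of an edge
      let z : T → ZMod 2 := fun x => if x = d ∨ x = e d then 1 else 0
      have hz : z ∈ Re := mem_invariantFunctions_apply.2 fun x => by
        have h1 : e x = d ↔ x = e d := ⟨fun h => by rw [← h, he], fun h => by rw [h, he]⟩
        have h2 : e x = e d ↔ x = d := ⟨fun h => by rw [← he x, h, he], fun h => by rw [h]⟩
        simp only [z, h1, h2, or_comm]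
      have h0 : ∑ x, y.1 x * z x = 0 := by
        rw [← hB ⟨z, hz⟩ y, ← LinearMap.flip_apply, h]; rfl
      have : ∑ x, y.1 x * z x = y.1 d + y.1 (e d) := by
        simp only [z, mul_ite, mul_one, mul_zero]
        rw [← Finset.sum_filter]
        have : Finset.univ.filter (fun x => x = d ∨ x = e d) = {d, e d} := by ext; simp
        rw [this, Finset.sum_pair (hne d).symm]
      rw [this] at h0
      exact (CharTwo.add_eq_zero.1 h0).symm
    · intro h
      ext z
      rw [LinearMap.flip_apply, hB]
      refine sum_eq_zero_of_involution he hne fun d => ?_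
      rw [(mem_invariantFunctions_or.1 h).1, mem_invariantFunctions_apply.1 z.2]
  -- boundaries are cycles: by `c (r (e d)) = c d` the sum of `y * c ∘ e` is that of `y * c`, shifted by `r`
  have hle : LinearMap.range S ≤ LinearMap.ker B := by
    rintro _ ⟨c, rfl⟩
    ext y
    have hy := mem_invariantFunctions_apply.1 y.2
    have hc := mem_invariantFunctions_apply.1 c.2
    have : ∑ d, y.1 d * c.1 (e d) = ∑ d, y.1 d * c.1 d := by
      rw [← hr.sum_comp fun d => y.1 d * c.1 d]
      refine Finset.sum_congr rfl fun d _ => ?_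
      have := hc (e d)
      rw [he] at this
      rw [hy, this]
    rw [hB]
    simp only [hS, mul_add, Finset.sum_add_distrib, this, two]
    rfl
  have r1 := LinearMap.finrank_range_add_finrank_ker S
  have r2 := LinearMap.finrank_range_add_finrank_ker B
  have r3 := LinearMap.finrank_range_add_finrank_ker B.flip
  rw [LinearMap.finrank_range_flip] at r3
  have hiff : IsAcyclic e r ↔ LinearMap.range S = LinearMap.ker B := by
    constructor
    · intro h
      refine le_antisymm hle fun z hz => ?_
      obtain ⟨c, hc, hzc⟩ := h z.1 (mem_invariantFunctions_apply.1 z.2) fun y hy => by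
        rw [← hB z ⟨y, mem_invariantFunctions_apply.2 hy⟩, LinearMap.mem_ker.1 hz]; rfl
      exact ⟨⟨c, mem_invariantFunctions_apply.2 hc⟩, by ext d; exact (hzc d).symm⟩
    · intro h z hz hy
      have hz' : (⟨z, mem_invariantFunctions_apply.2 hz⟩ : Re) ∈ LinearMap.ker B := by
        ext y
        exact hy y.1 (mem_invariantFunctions_apply.1 y.2)
      rw [← h] at hz'
      obtain ⟨c, hc⟩ := hz'
      exact ⟨c.1, mem_invariantFunctions_apply.1 c.2, fun d => by
        rw [← hS, hc]⟩
  have hcard : LinearMap.range S = LinearMap.ker B ↔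
      Module.finrank (ZMod 2) (LinearMap.range S) = Module.finrank (ZMod 2) (LinearMap.ker B) :=
    ⟨fun h => by rw [h], fun h => Submodule.eq_of_le_of_finrank_eq hle h⟩
  rw [hiff, hcard]
  omega

/-- Splitting a vertex with the successive darts `p, r p, r (r p), r (r (r p))` into a vertex with
the darts `r p, r (r p)` and a vertex with the other two does not destroy the vanishing of homology:
the new cycle conditions are just what makes the old face functions descend to the new faces. -/
theorem IsAcyclic.split [Fintype T] {e r r' : T → T} (h : IsAcyclic e r) (he : ∀ d, e (e d) = d)
    (p : T) (hp : r (r (r (r p))) = p) (h01 : r p ≠ r (r p)) (h23 : p ≠ r (r (r p)))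
    (h1 : r' (r p) = r (r p)) (h2 : r' (r (r p)) = r p)
    (h3 : r' (r (r (r p))) = p) (h0 : r' p = r (r (r p)))
    (hpair : ∀ d, (r' d = r p ∨ r' d = r (r p) ↔ d = r p ∨ d = r (r p)) ∧
      (r' d = p ∨ r' d = r (r (r p)) ↔ d = p ∨ d = r (r (r p))))
    (hother : ∀ d, d ≠ p → d ≠ r p → d ≠ r (r p) → d ≠ r (r (r p)) → r' d = r d) :
    IsAcyclic e r' := by
  classical
  intro z hz hy
  -- a function on the old vertices is one on the new vertices, so that `z` is an old cycle
  obtain ⟨c, hc, hzc⟩ := h z hz fun y hy' => hy y fun d => by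
    by_cases d0 : d = p
    · rw [d0, h0, hy', hy', hy']
    by_cases d1 : d = r p
    · rw [d1, h1, hy']
    by_cases d2 : d = r (r p)
    · rw [d2, h2, hy' (r p)]
    by_cases d3 : d = r (r (r p))
    · rw [d3, h3, hy', hy', hy']
    rw [hother d d0 d1 d2 d3, hy']
  -- the cycle condition of a new vertex, which has only the two darts `a` and `b`
  have pair (a b : T) (hab : a ≠ b) (hinv : ∀ d, r' d = a ∨ r' d = b ↔ d = a ∨ d = b) :
      z a + z b = 0 := by
    have := hy (fun x => if x = a ∨ x = b then 1 else 0) fun d => by simp only [hinv]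
    simp only [ite_mul, one_mul, zero_mul] at this
    rw [← Finset.sum_filter] at this
    have hs : Finset.univ.filter (fun x => x = a ∨ x = b) = {a, b} := by ext; simp
    rwa [hs, Finset.sum_pair hab] at this
  have e1 := pair _ _ h01 fun d => (hpair d).1
  have e2 := pair _ _ h23 fun d => (hpair d).2
  have hc' : ∀ d, c (r d) = c (e d) := fun d => by rw [← hc (e d), he]
  have g0 := hc' p
  have g1 := hc' (r p)
  have g2 := hc' (r (r p))
  have g3 := hc' (r (r (r p)))
  rw [hp] at g3
  rw [hzc, hzc] at e1 e2
  -- `c` is constant on the new faces: at the split vertex this is what `e1` and `e2` say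
  refine ⟨c, fun d => ?_, hzc⟩
  suffices ∀ d, c (r' d) = c (e d) by rw [this, he]
  intro d
  by_cases d0 : d = p
  · subst d0; rw [h0]; grind
  by_cases d1 : d = r p
  · subst d1; rw [h1]; grind
  by_cases d2 : d = r (r p)
  · subst d2; rw [h2]; grind
  by_cases d3 : d = r (r (r p))
  · subst d3; rw [h3]; grind
  rw [hother d d0 d1 d2 d3, hc']

theorem IsAcyclic.congr {T' : Type*} [Fintype T] [Fintype T'] {e r : T → T} {e' r' : T' → T'}
    (h : IsAcyclic e r) (φ : T ≃ T') (he : ∀ d, φ (e d) = e' (φ d)) (hr : ∀ d, φ (r d) = r' (φ d)) :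
    IsAcyclic e' r' := by
  intro z hz hy
  obtain ⟨c, hc, hzc⟩ := h (z ∘ φ) (fun d => by simp only [Function.comp_apply, he, hz]) fun y hy' => by
    rw [← hy (y ∘ φ.symm), ← φ.sum_comp]
    · simp
    · intro d
      obtain ⟨d, rfl⟩ := φ.surjective d
      simp [← hr, hy']
  refine ⟨c ∘ φ.symm, fun d => ?_, fun d => ?_⟩ <;> obtain ⟨d, rfl⟩ := φ.surjective d
  · simp [← he, ← hr, hc]
  · simpa [← he] using hzc d

end Homology

namespace Dart

variable {X M X' M' : Type}

instance [Finite X] [Finite M] : Finite (Dart X M) := by unfold Dart; infer_instance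

theorem rot_bijective : Function.Bijective (rot : Dart X M → Dart X M) := by
  refine Function.bijective_iff_has_inverse.2
    ⟨Sum.map (fun p => (p.1, p.2 - 1)) fun p => (p.1, p.2 - 1), ?_, ?_⟩ <;>
  rintro (⟨x, i⟩ | ⟨m, j⟩) <;> simp [rot]

theorem opp_opp (d : Dart X M) : d.opp.opp = d := by
  rcases d with ⟨x, i⟩ | ⟨m, j⟩
  · have : i + 2 + 2 = i := by revert i; decide
    simp [opp, this]
  · have : j + 1 + 1 = j := by revert j; decide
    simp [opp, this]

theorem opp_ne (d : Dart X M) : d.opp ≠ d := by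
  rcases d with ⟨x, i⟩ | ⟨m, j⟩
  · have : i + 2 ≠ i := by revert i; decide
    simpa [opp] using this
  · simp [opp]

theorem apply_opp {α : Type*} {y : Dart X M → α} (hy : ∀ d, y d.rot = y d) (d : Dart X M) :
    y d.opp = y d := by
  rcases d with ⟨x, i⟩ | ⟨m, j⟩
  · have h1 := hy (.inl (x, i))
    have h2 := hy (.inl (x, i + 1))
    have : i + 1 + 1 = i + 2 := by ring
    simp only [rot, this] at h1 h2
    simp only [opp]; rw [h2, h1]
  · exact hy (.inr (m, j))

/-- The orbits of the rotation are the vertices. -/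
theorem card_quot_rot [Finite X] [Finite M] :
    Nat.card (Quot fun d d' : Dart X M => d' = d.rot) = Nat.card X + Nat.card M := by
  rw [← Nat.card_sum]
  let f : Dart X M → X ⊕ M := Sum.map Prod.fst Prod.fst
  refine Nat.card_congr (Equiv.ofBijective (Quot.lift f ?_) ⟨?_, ?_⟩)
  · rintro (⟨x, i⟩ | ⟨m, j⟩) _ rfl <;> rfl
  · intro q q'
    induction q using Quot.ind with | _ d
    induction q' using Quot.ind with | _ d'
    have hrot (d : Dart X M) : Quot.mk (fun d d' : Dart X M => d' = d.rot) d.rot = Quot.mk _ d :=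
      (Quot.sound (r := fun d d' : Dart X M => d' = d.rot) rfl).symm
    have hx (x : X) (i : ZMod 4) : Quot.mk (fun d d' : Dart X M => d' = d.rot) (.inl (x, i)) =
        Quot.mk _ (.inl (x, 0)) := by
      have h1 := hrot (.inl (x, 0))
      have h2 := hrot (.inl (x, 1))
      have h3 := hrot (.inl (x, 2))
      fin_cases i
      · rfl
      · exact h1
      · exact h2.trans h1
      · exact h3.trans (h2.trans h1)
    have hm (m : M) (j : ZMod 2) : Quot.mk (fun d d' : Dart X M => d' = d.rot) (.inr (m, j)) =
        Quot.mk _ (.inr (m, 0)) := by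
      have h1 := hrot (.inr (m, 0))
      fin_cases j
      · rfl
      · exact h1
    rcases d with ⟨x, i⟩ | ⟨m, j⟩ <;> rcases d' with ⟨x', i'⟩ | ⟨m', j'⟩ <;> intro h <;>
      simp only [f, Sum.map_inl, Sum.map_inr, Sum.inl.injEq, Sum.inr.injEq, reduceCtorEq] at h
    · subst h; rw [hx, hx x i']
    · subst h; rw [hm, hm m j']
  · rintro (x | m)
    · exact ⟨Quot.mk _ (.inl (x, 0)), rfl⟩
    · exact ⟨Quot.mk _ (.inr (m, 0)), rfl⟩

end Dart

namespace SurfaceDiagram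

instance (D : SurfaceDiagram) : Finite D.Crossing := D.finite_crossing

instance (D : SurfaceDiagram) : Finite D.Mark := D.finite_mark

theorem isPlanar_iff_isAcyclic (D : SurfaceDiagram) [Fintype (Dart D.Crossing D.Mark)] :
    D.IsPlanar ↔ IsAcyclic D.edge Dart.rot := by
  rw [← euler_iff_isAcyclic D.edge Dart.rot D.edge_edge D.edge_ne Dart.rot_bijective,
    Dart.card_quot_rot]
  rfl

/-- The faces of a planar diagram can be coloured like a checkerboard. The colour of the face beside
a dart changes at every edge and at every step around a vertex. -/
theorem IsPlanar.exists_checkerboard {D : SurfaceDiagram} (hD : D.IsPlanar) :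
    ∃ σ : Dart D.Crossing D.Mark → Bool, (∀ d, σ (D.edge d) = !σ d) ∧ ∀ d, σ d.rot = !σ d := by
  classical
  have := Fintype.ofFinite (Dart D.Crossing D.Mark)
  -- the sum of all edges is a cycle because all vertices have even valency
  obtain ⟨c, hc, h1⟩ := D.isPlanar_iff_isAcyclic.1 hD (fun _ => 1) (fun _ => rfl) fun y hy => by
    simp only [mul_one]
    exact sum_eq_zero_of_involution Dart.opp_opp Dart.opp_ne (Dart.apply_opp hy)
  have key : ∀ x y : ZMod 2, 1 = x + y → decide (y = 1) = !decide (x = 1) := by decide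
  have he (d) : decide (c (D.edge d) = 1) = !decide (c d = 1) := key _ _ (h1 d)
  refine ⟨fun d => decide (c d = 1), he, fun d => ?_⟩
  have := hc (D.edge d)
  rw [D.edge_edge] at this
  simp only [this, he]

end SurfaceDiagram

/-! ### Counting loops -/

section Loops

variable {T U : Type*}

/-- The number of classes of the equivalence relation generated by two maps. For the pairing `ε` of
darts to edges and a pairing `τ` of the darts at each vertex it is the number of closed curves. -/
noncomputable def loopCount (ε τ : T → T) : ℕ := Nat.card (Quot fun x y => y = ε x ∨ y = τ x)

theorem loopCount_pos [Finite T] [Nonempty T] (ε τ : T → T) : 0 < loopCount ε τ := by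
  have : Nonempty (Quot fun x y => y = ε x ∨ y = τ x) := (Nonempty.map (Quot.mk _) ‹_›)
  exact Nat.card_pos

/-- The classes of `r` when a part of `T` is eliminated: `q` sends every point of `T` to an
equivalent point that is kept, or to the label of a class without such points. -/
theorem card_quot_eq_add {K : Type*} [Finite T] [Finite U] [Finite K] (r : T → T → Prop)
    (r' : U → U → Prop) (p : U → T) (k : K → T) (q : T → U ⊕ K)
    (hr : ∀ x y, r x y → Sum.map (Quot.mk r') id (q x) = Sum.map (Quot.mk r') id (q y))
    (hp : ∀ u, Sum.map (Quot.mk r') id (q (p u)) = .inl (Quot.mk r' u)) (hk : ∀ j, q (k j) = .inr j)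
    (hr' : ∀ u v, r' u v → Quot.mk r (p u) = Quot.mk r (p v))
    (hq : ∀ t, Quot.mk r t = Quot.mk r (Sum.elim p k (q t))) :
    Nat.card (Quot r) = Nat.card (Quot r') + Nat.card K := by
  rw [← Nat.card_sum]
  refine Nat.card_congr
    { toFun := Quot.lift (fun t => Sum.map (Quot.mk r') id (q t)) hr
      invFun := Sum.elim (Quot.lift (fun u => Quot.mk r (p u)) hr') fun j => Quot.mk r (k j)
      left_inv := fun x => ?_
      right_inv := fun x => ?_ }
  · induction x using Quot.ind with | _ t
    have := hq t
    simp only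
    rcases h : q t with u | j <;> rw [h] at this <;> exact this.symm
  · rcases x with x | j
    · induction x using Quot.ind with | _ u
      exact hp u
    · simp [hk]

theorem loopCount_congr {ε τ : T → T} {ε' τ' : U → U} (φ : T ≃ U) (hε : ∀ x, φ (ε x) = ε' (φ x))
    (hτ : ∀ x, φ (τ x) = τ' (φ x)) : loopCount ε τ = loopCount ε' τ' := by
  refine Nat.card_congr (Quot.congr φ fun x y => ?_)
  rw [← hε, ← hτ, φ.apply_eq_iff_eq, φ.apply_eq_iff_eq]

/-- Identifying two points lowers the number of classes by one unless they were equivalent before.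
-/
theorem card_quot_eq_card_quot_or [Finite T] (r : T → T → Prop) (p q : T) [Decidable (Quot.mk r p = Quot.mk r q)] :
    Nat.card (Quot r) = Nat.card (Quot fun x y => r x y ∨ (x = p ∧ y = q)) +
      if Quot.mk r p = Quot.mk r q then 0 else 1 := by
  classical
  split_ifs with h
  · refine Nat.card_congr
      { toFun := Quot.lift (Quot.mk _) fun x y hxy => Quot.sound (.inl hxy)
        invFun := Quot.lift (Quot.mk _) ?_
        left_inv := fun x => by induction x using Quot.ind; rfl
        right_inv := fun x => by induction x using Quot.ind; rfl }
    rintro x y (hxy | ⟨rfl, rfl⟩)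
    exacts [Quot.sound hxy, h]
  · let s : T → T → Prop := fun x y => r x y ∨ (x = p ∧ y = q)
    have hs : Quot.mk s p = Quot.mk s q := Quot.sound (.inr ⟨rfl, rfl⟩)
    -- the classes of the coarser relation are those of `r` other than that of `q`
    have e : Quot s ≃ {x : Quot r // x ≠ Quot.mk r q} :=
      { toFun := Quot.lift
          (fun x => if hx : Quot.mk r x = Quot.mk r q then ⟨Quot.mk r p, h⟩ else ⟨Quot.mk r x, hx⟩) (by
            rintro x y (hxy | ⟨rfl, rfl⟩)
            · rw [Quot.sound hxy]
            · simp [h])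
        invFun := fun x => Quot.lift (Quot.mk s) (fun x y hxy => Quot.sound (.inl hxy)) x.1
        left_inv := fun x => by
          induction x using Quot.ind with | _ x
          simp only
          split_ifs with hx
          · have := congrArg (Quot.lift (Quot.mk s) fun x y hxy => Quot.sound (.inl hxy)) hx
            exact hs.trans this.symm
          · rfl
        right_inv := fun x => by
          obtain ⟨x, hx⟩ := x
          induction x using Quot.ind with | _ x
          simp [hx] }
    rw [Nat.card_congr e, ← Nat.card_congr (Equiv.optionSubtypeNe (Quot.mk r q)), Finite.card_option]

/-- Each of two distinct points of a finite set with an injective self-map `φ` returns to the pair.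
-/
theorem exists_first_return [Finite T] {φ : T → T} (hφ : φ.Injective) (p q : T) :
    ∃ n > 0, (φ^[n] p = p ∨ φ^[n] p = q) ∧ ∀ j, 0 < j → j < n → φ^[j] p ≠ p ∧ φ^[j] p ≠ q := by
  classical
  have hex : ∃ n, 0 < n ∧ (φ^[n] p = p ∨ φ^[n] p = q) :=
    ⟨Function.minimalPeriod φ p, Function.minimalPeriod_pos_of_mem_periodicPts
      (hφ.mem_periodicPts p), .inl (Function.iterate_minimalPeriod)⟩
  refine ⟨Nat.find hex, (Nat.find_spec hex).1, (Nat.find_spec hex).2, fun j h0 hj => ?_⟩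
  have := Nat.find_min hex hj
  tauto

/-- The pairing after a saddle move is an involution again. -/
theorem saddle_involutive {τ τ' : T → T} {p q : T} (hτ : ∀ x, τ (τ x) = x)
    (hp : τ' p = τ q) (hq : τ' q = τ p) (hp' : τ' (τ p) = q) (hq' : τ' (τ q) = p)
    (h : ∀ x, x ≠ p → x ≠ q → x ≠ τ p → x ≠ τ q → τ' x = τ x) (x : T) : τ' (τ' x) = x := by
  by_cases h1 : x = p
  · rw [h1, hp, hq']
  by_cases h2 : x = q
  · rw [h2, hq, hp']
  by_cases h3 : x = τ p
  · rw [h3, hp', hq]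
  by_cases h4 : x = τ q
  · rw [h4, hq', hp]
  rw [h x h1 h2 h3 h4, h, hτ]
  · rintro rfl; exact h3 (hτ x).symm
  · rintro rfl; exact h4 (hτ x).symm
  · intro h5; exact h1 (by rw [← hτ x, h5, hτ])
  · intro h5; exact h2 (by rw [← hτ x, h5, hτ])

/-- A saddle move on a checkerboard coloured system of closed curves. The pairs `p, τ p` and
`q, τ q` are replaced by `p, τ q` and `q, τ p`; if `p` and `q` have the same colour, then they are
on the same curve either before or after the move. -/
theorem saddle_joined_iff [Finite T] {ε τ τ' : T → T} {σ : T → Bool} {p q : T}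
    (hε : ∀ x, ε (ε x) = x) (hτ : ∀ x, τ (τ x) = x) (hσε : ∀ x, σ (ε x) = !σ x)
    (hστ : ∀ x, σ (τ x) = !σ x) (hpq : p ≠ q) (hσ : σ p = σ q)
    (hp : τ' p = τ q) (hq : τ' q = τ p) (hp' : τ' (τ p) = q) (hq' : τ' (τ q) = p)
    (h : ∀ x, x ≠ p → x ≠ q → x ≠ τ p → x ≠ τ q → τ' x = τ x) :
    Quot.mk (fun x y => y = ε x ∨ y = τ x) p = Quot.mk _ q ↔
      ¬ Quot.mk (fun x y => y = ε x ∨ y = τ' x) p = Quot.mk _ q := by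
  set φ : T → T := fun x => ε (τ x) with hφdef
  have hφ : φ.Injective := fun x y hxy => by
    have h1 := congrArg ε hxy
    simp only [hφdef, hε] at h1
    rw [← hτ x, h1, hτ]
  have hσφ (n : ℕ) (x : T) : σ (φ^[n] x) = σ x := by
    induction n with
    | zero => rfl
    | succ n ih => rw [Function.iterate_succ_apply', hφdef, hσε, hστ, ih, Bool.not_not]
  obtain ⟨n, hn, hreturn, hmin⟩ := exists_first_return hφ p q
  have hφτ (x : T) : ε (φ x) = τ x := hε _
  -- a set that is closed under both maps and separates two points shows that they are not equivalent
  have separate (τ : T → T) (A : T → Prop) (hA : ∀ x, A (ε x) ↔ A x) (hA' : ∀ x, A x → A (τ x))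
      (hinv : ∀ x, τ (τ x) = x) {a b : T} (ha : A a) (hb : ¬ A b) :
      Quot.mk (fun x y => y = ε x ∨ y = τ x) a ≠ Quot.mk _ b := by
    intro hab
    have := congrArg (Quot.lift A (by
      rintro x y (rfl | rfl)
      · exact propext (hA x).symm
      · exact propext ⟨hA' x, fun h => by simpa [hinv] using hA' _ h⟩)) hab
    exact hb (this.mp ha)
  have hτ'τ' := saddle_involutive hτ hp hq hp' hq' h
  -- the colour keeps the points `φ^[j] p` apart from `τ p` and `τ q`
  have hne (j : ℕ) : φ^[j] p ≠ τ p ∧ φ^[j] p ≠ τ q := by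
    constructor <;> intro hj <;> have := congrArg σ hj <;> rw [hσφ, hστ] at this
    · exact absurd this.symm (by simp)
    · rw [← hσ] at this; exact absurd this.symm (by simp)
  -- the stretch of the curve from `φ p` to the first return, with the other ends of its edges
  let A : T → Prop := fun x => ∃ j, 0 < j ∧ j ≤ n ∧ (x = φ^[j] p ∨ x = ε (φ^[j] p))
  have hA (x : T) : A (ε x) ↔ A x := by
    have : ∀ x, A x → A (ε x) := by
      rintro x ⟨j, h0, hj, rfl | rfl⟩
      · exact ⟨j, h0, hj, .inr rfl⟩
      · exact ⟨j, h0, hj, .inl (hε _)⟩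
    exact ⟨fun hx => by simpa [hε] using this _ hx, this x⟩
  have hεφ (j : ℕ) : ε (φ^[j + 1] p) = τ (φ^[j] p) := by
    rw [Function.iterate_succ_apply', hφτ]
  have hAp : φ^[n] p = q → ¬ A p := by
    rintro hq ⟨j, h0, hj, hpj | hpj⟩
    · rcases hj.lt_or_eq with hj | rfl
      · exact (hmin j h0 hj).1 hpj.symm
      · exact hpq (hpj.trans hq)
    · have := congrArg σ hpj
      rw [hσε, hσφ] at this
      exact absurd this (by simp)
  have hAq : φ^[n] p = p → ¬ A q := by
    rintro hp ⟨j, h0, hj, hpj | hpj⟩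
    · rcases hj.lt_or_eq with hj | rfl
      · exact (hmin j h0 hj).2 hpj.symm
      · exact hpq (hp.symm.trans hpj.symm)
    · have := congrArg σ hpj
      rw [hσε, hσφ, hσ] at this
      exact absurd this (by simp)
  have hlast : A (φ^[n] p) := ⟨n, hn, le_rfl, .inl rfl⟩
  have hfirst : A (τ p) := ⟨1, one_pos, hn, .inr (by simpa using (hεφ 0).symm)⟩
  -- going along the curve from `p` one returns to `p` before meeting `q`, or meets `q` first
  rcases hreturn with hret | hret
  · have h1 : Quot.mk (fun x y => y = ε x ∨ y = τ x) p ≠ Quot.mk _ q := by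
      refine separate τ A hA ?_ hτ (hret ▸ hlast) (hAq hret)
      rintro _ ⟨j, h0, hj, rfl | rfl⟩
      · rcases hj.lt_or_eq with hj | rfl
        · exact ⟨j + 1, by omega, hj, .inr (hεφ j).symm⟩
        · rw [hret]; exact hfirst
      · obtain ⟨i, rfl⟩ : ∃ i, j = i + 1 := ⟨j - 1, by omega⟩
        rw [hεφ, hτ]
        rcases Nat.eq_zero_or_pos i with rfl | hi
        · exact hret ▸ hlast
        · exact ⟨i, hi, by omega, .inl rfl⟩
    have h2 : Quot.mk (fun x y => y = ε x ∨ y = τ' x) p = Quot.mk _ q := by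
      have step (j : ℕ) (hj : j < n) :
          Quot.mk (fun x y => y = ε x ∨ y = τ' x) (φ^[j + 1] p) = Quot.mk _ q := by
        rw [Quot.sound (r := fun x y => y = ε x ∨ y = τ' x) (.inl rfl), hεφ]
        induction j with
        | zero =>
          rw [Function.iterate_zero, id, ← hq]
          exact (Quot.sound (r := fun x y => y = ε x ∨ y = τ' x) (.inr rfl)).symm
        | succ j ih =>
          have hm := hmin (j + 1) (by omega) hj
          rw [← h _ hm.1 hm.2 (hne _).1 (hne _).2,
            ← Quot.sound (r := fun x y => y = ε x ∨ y = τ' x) (.inr rfl),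
            Quot.sound (r := fun x y => y = ε x ∨ y = τ' x) (.inl rfl), hεφ]
          exact ih (by omega)
      obtain ⟨i, rfl⟩ : ∃ i, n = i + 1 := ⟨n - 1, by omega⟩
      have := step i (by omega)
      rwa [hret] at this
    exact iff_of_false h1 (not_not.2 h2)
  · have h1 : Quot.mk (fun x y => y = ε x ∨ y = τ x) p = Quot.mk _ q := by
      have step (j : ℕ) : Quot.mk (fun x y => y = ε x ∨ y = τ x) (φ^[j] p) = Quot.mk _ p := by
        induction j with
        | zero => rfl
        | succ j ih =>
          rw [Quot.sound (r := fun x y => y = ε x ∨ y = τ x) (.inl rfl), hεφ, ← ih]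
          exact (Quot.sound (r := fun x y => y = ε x ∨ y = τ x) (.inr rfl)).symm
      rw [← hret, step]
    have h2 : Quot.mk (fun x y => y = ε x ∨ y = τ' x) q ≠ Quot.mk _ p := by
      refine separate τ' A hA ?_ hτ'τ' (hret ▸ hlast) (hAp hret)
      rintro _ ⟨j, h0, hj, rfl | rfl⟩
      · rcases hj.lt_or_eq with hj | rfl
        · have hm := hmin j h0 hj
          rw [h _ hm.1 hm.2 (hne _).1 (hne _).2]
          exact ⟨j + 1, by omega, hj, .inr (hεφ j).symm⟩
        · rw [hret, hq]; exact hfirst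
      · obtain ⟨i, rfl⟩ : ∃ i, j = i + 1 := ⟨j - 1, by omega⟩
        rw [hεφ]
        rcases Nat.eq_zero_or_pos i with rfl | hi
        · simp only [Function.iterate_zero, id, hp']
          exact hret ▸ hlast
        · have hm := hmin i hi (by omega)
          have : τ' (τ (φ^[i] p)) = φ^[i] p := by
            rw [← h _ hm.1 hm.2 (hne _).1 (hne _).2, hτ'τ']
          rw [this]
          exact ⟨i, hi, by omega, .inl rfl⟩
    exact iff_of_true h1 fun h => h2 h.symm

/-- On a checkerboard coloured system of closed curves, a saddle move changes the number of curves
by exactly one: both systems become the same when `p` and `q` are identified, and just one of them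
loses a curve by this. -/
theorem loopCount_saddle [Finite T] {ε τ τ' : T → T} {σ : T → Bool} {p q : T}
    (hε : ∀ x, ε (ε x) = x) (hτ : ∀ x, τ (τ x) = x) (hσε : ∀ x, σ (ε x) = !σ x)
    (hστ : ∀ x, σ (τ x) = !σ x) (hpq : p ≠ q) (hσ : σ p = σ q)
    (hp : τ' p = τ q) (hq : τ' q = τ p) (hp' : τ' (τ p) = q) (hq' : τ' (τ q) = p)
    (h : ∀ x, x ≠ p → x ≠ q → x ≠ τ p → x ≠ τ q → τ' x = τ x) :
    loopCount ε τ = loopCount ε τ' + 1 ∨ loopCount ε τ' = loopCount ε τ + 1 := by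
  classical
  have key := saddle_joined_iff hε hτ hσε hστ hpq hσ hp hq hp' hq' h
  have c1 := card_quot_eq_card_quot_or (fun x y => y = ε x ∨ y = τ x) p q
  have c2 := card_quot_eq_card_quot_or (fun x y => y = ε x ∨ y = τ' x) p q
  have heq : Nat.card (Quot fun x y => (y = ε x ∨ y = τ x) ∨ (x = p ∧ y = q)) =
      Nat.card (Quot fun x y => (y = ε x ∨ y = τ' x) ∨ (x = p ∧ y = q)) := by
    -- stated for arbitrary pairings, since the situation is symmetric in the two
    have aux (τ τ' : T → T) (hτ : ∀ x, τ (τ x) = x) (hp : τ' p = τ q) (hq : τ' q = τ p)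
        (hp' : τ' (τ p) = q) (hq' : τ' (τ q) = p)
        (h : ∀ x, x ≠ p → x ≠ q → x ≠ τ p → x ≠ τ q → τ' x = τ x) (x y : T)
        (hxy : (y = ε x ∨ y = τ x) ∨ (x = p ∧ y = q)) :
        Quot.mk (fun x y => (y = ε x ∨ y = τ' x) ∨ (x = p ∧ y = q)) x = Quot.mk _ y := by
      have sτ (x : T) : Quot.mk (fun x y => (y = ε x ∨ y = τ' x) ∨ (x = p ∧ y = q)) x =
        Quot.mk _ (τ' x) := Quot.sound (.inl (.inr rfl))
      have spq : Quot.mk (fun x y => (y = ε x ∨ y = τ' x) ∨ (x = p ∧ y = q)) p =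
        Quot.mk _ q := Quot.sound (.inr ⟨rfl, rfl⟩)
      rcases hxy with (rfl | rfl) | hxy
      · exact Quot.sound (.inl (.inl rfl))
      · by_cases h1 : x = p
        · rw [h1, spq, sτ q, hq]
        by_cases h2 : x = q
        · rw [h2, ← spq, sτ p, hp]
        by_cases h3 : x = τ p
        · rw [h3, hτ, spq, sτ (τ p), hp']
        by_cases h4 : x = τ q
        · rw [h4, hτ, ← spq, sτ (τ q), hq']
        rw [sτ x, h x h1 h2 h3 h4]
      · exact Quot.sound (.inr hxy)
    refine Nat.card_congr
      { toFun := Quot.lift (Quot.mk _) (aux τ τ' hτ hp hq hp' hq' h)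
        invFun := Quot.lift (Quot.mk _) ?_
        left_inv := fun x => by induction x using Quot.ind; rfl
        right_inv := fun x => by induction x using Quot.ind; rfl }
    refine aux τ' τ (saddle_involutive hτ hp hq hp' hq' h) hq.symm hp.symm ?_ ?_ ?_
    · rw [hp, hτ]
    · rw [hq, hτ]
    · intro x h1 h2 h3 h4
      rw [hp] at h3
      rw [hq] at h4
      exact (h x h1 h2 h4 h3).symm
  unfold loopCount
  by_cases hj : Quot.mk (fun x y => y = ε x ∨ y = τ x) p = Quot.mk _ q
  · rw [if_pos hj] at c1
    rw [if_neg (key.1 hj)] at c2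
    omega
  · rw [if_neg hj] at c1
    rw [if_pos (not_not.1 (mt key.2 hj))] at c2
    omega

end Loops

/-! ### State sums -/

section StateSum

variable {R : Type*} [CommRing R] (A B : R)

/-- The sum over all states `s` of a set `C` of crossings, where a crossing has the weight `A` if
its state is `true` and `B` otherwise. -/
noncomputable def stateSum (C : Type*) [Finite C] (Ψ : (C → Bool) → R) : R :=
  letI := Fintype.ofFinite C
  letI := Classical.decEq C
  ∑ s : C → Bool, (∏ x, if s x then A else B) * Ψ s

theorem stateSum_eq (C : Type*) [Fintype C] [DecidableEq C] (Ψ : (C → Bool) → R) :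
    stateSum A B C Ψ = ∑ s : C → Bool, (∏ x, if s x then A else B) * Ψ s := by
  unfold stateSum
  congr! 4 with s

theorem stateSum_equiv {C C' : Type*} [Finite C] [Finite C'] (e : C ≃ C') (Ψ : (C → Bool) → R) :
    stateSum A B C Ψ = stateSum A B C' fun s => Ψ (s ∘ e) := by
  classical
  have := Fintype.ofFinite C
  have := Fintype.ofFinite C'
  rw [stateSum_eq, stateSum_eq]
  refine Fintype.sum_equiv (e.arrowCongr (Equiv.refl Bool)) _ _ fun s => ?_
  congr 1
  · exact Fintype.prod_equiv e _ _ fun x => by simp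
  · congr 1; ext x; simp

theorem stateSum_sum (C C' : Type*) [Finite C] [Finite C'] (Ψ : (C ⊕ C' → Bool) → R) :
    stateSum A B (C ⊕ C') Ψ =
      stateSum A B C fun s => stateSum A B C' fun t => Ψ (Sum.elim s t) := by
  classical
  have := Fintype.ofFinite C
  have := Fintype.ofFinite C'
  simp only [stateSum_eq]
  rw [← (Equiv.sumArrowEquivProdArrow C C' Bool).symm.sum_comp, Fintype.sum_prod_type]
  refine Finset.sum_congr rfl fun s _ => ?_
  rw [Finset.mul_sum]
  refine Finset.sum_congr rfl fun t _ => ?_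
  rw [Fintype.prod_sum_type, ← mul_assoc]
  rfl

theorem mul_stateSum (r : R) (C : Type*) [Finite C] (Ψ : (C → Bool) → R) :
    r * stateSum A B C Ψ = stateSum A B C fun s => r * Ψ s := by
  classical
  have := Fintype.ofFinite C
  rw [stateSum_eq, stateSum_eq, Finset.mul_sum]
  exact Finset.sum_congr rfl fun _ _ => mul_left_comm _ _ _

theorem stateSum_add (C : Type*) [Finite C] (Ψ Ψ' : (C → Bool) → R) :
    stateSum A B C (fun s => Ψ s + Ψ' s) = stateSum A B C Ψ + stateSum A B C Ψ' := by
  classical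
  have := Fintype.ofFinite C
  simp only [stateSum_eq, mul_add, Finset.sum_add_distrib]

theorem stateSum_of_isEmpty (C : Type*) [Finite C] [IsEmpty C] (Ψ : (C → Bool) → R) :
    stateSum A B C Ψ = Ψ isEmptyElim := by
  classical
  have := Fintype.ofFinite C
  rw [stateSum_eq, Fintype.sum_eq_single isEmptyElim fun s hs => absurd (Subsingleton.elim _ _) hs]
  simp

theorem stateSum_unique (C : Type*) [Finite C] [Unique C] (Ψ : (C → Bool) → R) :
    stateSum A B C Ψ = A * Ψ (fun _ => true) + B * Ψ (fun _ => false) := by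
  classical
  have := Fintype.ofFinite C
  rw [stateSum_eq, ← (Equiv.funUnique C Bool).symm.sum_comp, Fintype.sum_bool]
  have h (b : Bool) : (Equiv.funUnique C Bool).symm b = fun _ => b := funext fun x => by
    simp [Equiv.funUnique, Subsingleton.elim x default]
  simp [h]

end StateSum

/-- The pairing of the darts at every vertex after the smoothing of all crossings. At a crossing `x`
it is that of `smoothI` if `s x` is true, and that of `smoothII` otherwise. -/
def Dart.smooth {X M : Type} (s : X → Bool) : Dart X M → Dart X M
  | .inl (x, i) => .inl (x, if s x then 3 - i else 1 - i)
  | .inr (m, j) => .inr (m, j + 1)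

theorem Dart.smooth_smooth {X M : Type} (s : X → Bool) (d : Dart X M) :
    Dart.smooth s (Dart.smooth s d) = d := by
  rcases d with ⟨x, i⟩ | ⟨m, j⟩
  · simp only [smooth]
    split_ifs <;> simp
  · have : j + 1 + 1 = j := by revert j; decide
    simp [smooth, this]

theorem Dart.apply_smooth {X M : Type} {σ : Dart X M → Bool} (hσ : ∀ d, σ d.rot = !σ d)
    (s : X → Bool) (d : Dart X M) : σ (Dart.smooth s d) = !σ d := by
  rcases d with ⟨x, i⟩ | ⟨m, j⟩
  · have h0 := hσ (.inl (x, 0))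
    have h1 := hσ (.inl (x, 1))
    have h2 := hσ (.inl (x, 2))
    simp only [rot] at h0 h1 h2
    replace h0 : σ (.inl (x, 1)) = !σ (.inl (x, 0)) := h0
    replace h1 : σ (.inl (x, 2)) = !σ (.inl (x, 1)) := h1
    replace h2 : σ (.inl (x, 3)) = !σ (.inl (x, 2)) := h2
    have key : σ (.inl (x, 3 - i)) = !σ (.inl (x, i)) ∧ σ (.inl (x, 1 - i)) = !σ (.inl (x, i)) := by
      have : i = 0 ∨ i = 1 ∨ i = 2 ∨ i = 3 := by revert i; decide
      rcases this with rfl | rfl | rfl | rfl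
      · rw [show (3 : ZMod 4) - 0 = 3 from rfl, show (1 : ZMod 4) - 0 = 1 from rfl]; simp [h0, h1, h2]
      · rw [show (3 : ZMod 4) - 1 = 2 from rfl, show (1 : ZMod 4) - 1 = 0 from rfl]; simp [h0, h1]
      · rw [show (3 : ZMod 4) - 2 = 1 from rfl, show (1 : ZMod 4) - 2 = 3 from rfl]; simp [h0, h1, h2]
      · rw [show (3 : ZMod 4) - 3 = 0 from rfl, show (1 : ZMod 4) - 3 = 2 from rfl]; simp [h0, h1, h2]
    simp only [smooth]
    split_ifs
    exacts [key.1, key.2]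
  · exact hσ (.inr (m, j))

/-- The state sum of a diagram: the sum over all states, with the value `v k` for `k` closed curves.
-/
noncomputable def SurfaceDiagram.bracket {R : Type*} [CommRing R] (A B : R) (v : ℕ → R)
    (D : SurfaceDiagram) : R :=
  stateSum A B D.Crossing fun s => v (loopCount D.edge (Dart.smooth s))

/-! ### Strands of local pictures -/

namespace LocalPicture

variable {n : ℕ}

/-- The vertices of the local picture can be listed. -/
class Effective (P : LocalPicture n) where
  decidableEqCrossing : DecidableEq P.Crossing
  decidableEqMark : DecidableEq P.Mark
  fintypeCrossing : Fintype P.Crossing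
  fintypeMark : Fintype P.Mark

attribute [reducible, instance] Effective.decidableEqCrossing Effective.decidableEqMark
  Effective.fintypeCrossing Effective.fintypeMark

variable (P : LocalPicture n) [P.Effective]

/-- The other half of an edge inside the disc; a dart that leaves the disc is sent to itself. -/
def partner (d : Dart P.Crossing P.Mark) : Dart P.Crossing P.Mark :=
  (((P.inner ++ P.inner.map Prod.swap).find? fun q => q.1 = d).map Prod.snd).getD d

/-- From `d` one reaches `d'` with at most `k` steps along the strand through `d`, where `τ` is the
pairing of the darts at the vertices. -/
def ReachesIn (τ : Dart P.Crossing P.Mark → Dart P.Crossing P.Mark) :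
    ℕ → Dart P.Crossing P.Mark → Dart P.Crossing P.Mark → Prop
  | 0, d, d' => d = d'
  | k + 1, d, d' => d = d' ∨ ReachesIn τ k (P.partner (τ d)) d'

instance decidableReachesIn (τ) : (k : ℕ) → ∀ d d', Decidable (P.ReachesIn τ k d d')
  | 0, d, d' => inferInstanceAs (Decidable (d = d'))
  | k + 1, d, d' =>
    have := decidableReachesIn τ k (P.partner (τ d)) d'
    inferInstanceAs (Decidable (d = d' ∨ P.ReachesIn τ k (P.partner (τ d)) d'))

/-- From `d` one reaches `d'` along the strand through `d`. No strand of the pictures that occur in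
Reidemeister moves has more than eight darts. -/
def Reaches (τ : Dart P.Crossing P.Mark → Dart P.Crossing P.Mark) (d d' : Dart P.Crossing P.Mark) :
    Prop :=
  P.ReachesIn τ 7 d d'

instance (τ d d') : Decidable (P.Reaches τ d d') := P.decidableReachesIn τ 7 d d'

/-- An end of the strand through `d`, if the strand is not closed. -/
def exit (τ : Dart P.Crossing P.Mark → Dart P.Crossing P.Mark) (d : Dart P.Crossing P.Mark) :
    Option (Fin n) :=
  (List.finRange n).find? fun j => P.Reaches τ d (P.ends j)

/-- The other end of the strand with the end `i`. -/
def matching (τ : Dart P.Crossing P.Mark → Dart P.Crossing P.Mark) (i : Fin n) : Fin n :=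
  ((List.finRange n).find? fun j => j ≠ i ∧ P.Reaches τ (P.ends i) (P.ends j)).getD i

/-- The number of closed strands, if it is at most one. -/
def closedCount (τ : Dart P.Crossing P.Mark → Dart P.Crossing P.Mark) : ℕ :=
  if ∃ d, P.exit τ d = none then 1 else 0

/-- Every dart of the picture either leaves the disc, or belongs to an edge inside the disc. -/
def IsTidy : Prop :=
  (∀ i j, P.ends i = P.ends j → i = j) ∧ (∀ i, P.partner (P.ends i) = P.ends i) ∧
    (∀ d, P.partner d = d → ∃ i, P.ends i = d) ∧ ∀ d, P.partner (P.partner d) = d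

-- Instance search finds the four conditions one by one, but not their conjunction.
instance : Decidable P.IsTidy := by
  have i1 : Decidable (∀ i j, P.ends i = P.ends j → i = j) := inferInstance
  have i2 : Decidable (∀ i, P.partner (P.ends i) = P.ends i) := inferInstance
  have i4 : Decidable (∀ d, P.partner (P.partner d) = d) := inferInstance
  have i3 : Decidable (∀ d, P.partner d = d → ∃ i, P.ends i = d) := inferInstance
  unfold IsTidy; infer_instance

/-- `exit` and `matching` describe the strands of the picture, and there is at most one closed
strand. -/
def IsResolved (τ : Dart P.Crossing P.Mark → Dart P.Crossing P.Mark) : Prop :=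
  (∀ i, P.exit τ (P.ends i) = some i ∨ P.exit τ (P.ends i) = some (P.matching τ i)) ∧
    (∀ d, P.exit τ (τ d) = P.exit τ d ∨ P.exit τ (τ d) = (P.exit τ d).map (P.matching τ)) ∧
    (∀ d, P.exit τ (P.partner d) = P.exit τ d ∨
      P.exit τ (P.partner d) = (P.exit τ d).map (P.matching τ)) ∧
    ∀ d, P.exit τ d = none → ∀ d', P.exit τ d' = none → P.Reaches τ d d' ∨ P.Reaches τ (τ d) d'

instance (τ) : Decidable (P.IsResolved τ) := by unfold IsResolved; infer_instance

theorem edge_of_partner_ne {d : Dart P.Crossing P.Mark} (h : P.partner d ≠ d) :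
    (d, P.partner d) ∈ P.inner ∨ (P.partner d, d) ∈ P.inner := by
  unfold partner at h ⊢
  rcases hq : (P.inner ++ P.inner.map Prod.swap).find? fun q => q.1 = d with _ | ⟨d₁, d₂⟩
  · simp [hq] at h
  · obtain rfl : d₁ = d := by simpa using List.find?_some hq
    rw [hq, Option.map_some, Option.getD_some]
    have := List.mem_of_find?_eq_some hq
    simpa using this

theorem reaches_of_exit_eq_some {τ : Dart P.Crossing P.Mark → Dart P.Crossing P.Mark}
    {d : Dart P.Crossing P.Mark} {i : Fin n} (h : P.exit τ d = some i) :
    P.Reaches τ d (P.ends i) := by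
  simpa using List.find?_some h

theorem reaches_matching (τ : Dart P.Crossing P.Mark → Dart P.Crossing P.Mark) (i : Fin n) :
    P.Reaches τ (P.ends i) (P.ends (P.matching τ i)) := by
  unfold matching
  rcases h : (List.finRange n).find? fun j => j ≠ i ∧ P.Reaches τ (P.ends i) (P.ends j) with _ | j
  · exact Or.inl rfl
  · have := List.find?_some h
    simp only [decide_eq_true_eq] at this
    exact this.2

end LocalPicture

/-! ### Placements and what lies outside -/

namespace Placement

variable {D D' : SurfaceDiagram} {n : ℕ} {P P' : LocalPicture n} {X M : Type}

/-- The darts of `D` at outside vertices. -/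
def outside (A : Placement D P X M) : Dart X M → Dart D.Crossing D.Mark :=
  Dart.map (A.crossing ∘ Sum.inl) (A.mark ∘ Sum.inl)

/-- The darts of `D` at the vertices of the local picture. -/
def inside (A : Placement D P X M) : Dart P.Crossing P.Mark → Dart D.Crossing D.Mark :=
  Dart.map (A.crossing ∘ Sum.inr) (A.mark ∘ Sum.inr)

theorem dart_bijective (A : Placement D P X M) : (Sum.elim A.outside A.inside).Bijective := by
  constructor
  · rintro ((⟨x, i⟩ | ⟨m, j⟩) | (⟨x, i⟩ | ⟨m, j⟩)) ((⟨x', i'⟩ | ⟨m', j'⟩) | (⟨x', i'⟩ | ⟨m', j'⟩)) <;>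
      simp [outside, inside, Dart.map]
  · rintro (⟨x, i⟩ | ⟨m, j⟩)
    · obtain ⟨x | x, rfl⟩ := A.crossing.surjective x
      · exact ⟨.inl (.inl (x, i)), rfl⟩
      · exact ⟨.inr (.inl (x, i)), rfl⟩
    · obtain ⟨m | m, rfl⟩ := A.mark.surjective m
      · exact ⟨.inl (.inr (m, j)), rfl⟩
      · exact ⟨.inr (.inr (m, j)), rfl⟩

theorem port_injective (A : Placement D P X M) [P.Effective] (hP : P.IsTidy) : A.port.Injective := by
  rintro (d | i) (d' | i') h
  · rw [Sum.inl_injective (A.dart_bijective.1 (a₁ := .inl d) (a₂ := .inl d') h)]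
  · exact absurd (A.dart_bijective.1 (a₁ := .inl d) (a₂ := .inr _) h) (by simp)
  · exact absurd (A.dart_bijective.1 (a₁ := .inr _) (a₂ := .inl d') h) (by simp)
  · rw [hP.1 _ _ (Sum.inr_injective (A.dart_bijective.1 (a₁ := .inr _) (a₂ := .inr _) h))]

theorem edge_inside (A : Placement D P X M) [P.Effective] {d : Dart P.Crossing P.Mark}
    (h : P.partner d ≠ d) : D.edge (A.inside d) = A.inside (P.partner d) := by
  rcases P.edge_of_partner_ne h with h | h
  · exact A.inner _ h
  · rw [← D.edge_edge (A.inside (P.partner d))]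
    exact congrArg D.edge (A.inner _ h).symm

/-- The darts that are visible from outside are paired among themselves. -/
theorem exists_edge_port (A : Placement D P X M) [P.Effective] (hP : P.IsTidy) (u : Dart X M ⊕ Fin n) :
    ∃ v, D.edge (A.port u) = A.port v := by
  obtain ⟨d | d, hd⟩ := A.dart_bijective.2 (D.edge (A.port u))
  · exact ⟨.inl d, hd.symm⟩
  · by_cases h : P.partner d = d
    · obtain ⟨i, rfl⟩ := hP.2.2.1 d h
      exact ⟨.inr i, hd.symm⟩
    · have h1 : A.port u = A.inside (P.partner d) := by
        rw [← A.edge_inside h, ← D.edge_edge (A.port u), ← hd]; rfl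
      rcases u with d' | i
      · exact absurd (A.dart_bijective.1 (a₁ := .inl d') (a₂ := .inr _) h1) (by simp)
      · have h2 := Sum.inr_injective (A.dart_bijective.1 (a₁ := .inr _) (a₂ := .inr _) h1)
        have h3 := hP.2.1 i
        rw [h2, hP.2.2.2] at h3
        exact absurd h3.symm h

/-- The pairing by edges of the darts that are visible from outside. -/
noncomputable def portEdge (A : Placement D P X M) [P.Effective] (hP : P.IsTidy)
    (u : Dart X M ⊕ Fin n) : Dart X M ⊕ Fin n :=
  (A.exists_edge_port hP u).choose

theorem edge_port (A : Placement D P X M) [P.Effective] (hP : P.IsTidy) (u : Dart X M ⊕ Fin n) :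
    D.edge (A.port u) = A.port (A.portEdge hP u) :=
  (A.exists_edge_port hP u).choose_spec

theorem portEdge_portEdge (A : Placement D P X M) [P.Effective] (hP : P.IsTidy)
    (u : Dart X M ⊕ Fin n) : A.portEdge hP (A.portEdge hP u) = u :=
  A.port_injective hP (by rw [← edge_port, ← edge_port, D.edge_edge])

theorem SameOutside.portEdge_eq {A : Placement D P X M} {B : Placement D' P' X M} [P.Effective]
    [P'.Effective] (h : A.SameOutside B) (hP : P.IsTidy) (hP' : P'.IsTidy) :
    A.portEdge hP = B.portEdge hP' := by
  ext1 u
  exact B.port_injective hP' (((h _ _).1 (A.edge_port hP u)).symm.trans (B.edge_port hP' u))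

theorem finite_outside (A : Placement D P X M) : Finite X ∧ Finite M :=
  ⟨Finite.of_injective _ (A.crossing.injective.comp Sum.inl_injective),
    Finite.of_injective _ (A.mark.injective.comp Sum.inl_injective)⟩

/-- Closed curves can be counted outside of a local picture: only the way in which the strands of
the picture connect its ends and the number of its closed strands matter. -/
theorem loopCount_eq (A : Placement D P X M) [P.Effective] (hP : P.IsTidy)
    {τ : Dart D.Crossing D.Mark → Dart D.Crossing D.Mark} {τo : Dart X M → Dart X M}
    {τi : Dart P.Crossing P.Mark → Dart P.Crossing P.Mark}
    (ho : ∀ d, τ (A.outside d) = A.outside (τo d)) (hi : ∀ d, τ (A.inside d) = A.inside (τi d))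
    (hτ : P.IsResolved τi) :
    loopCount D.edge τ =
      loopCount (A.portEdge hP) (Sum.map τo (P.matching τi)) + P.closedCount τi := by
  have := A.finite_outside.1
  have := A.finite_outside.2
  let e := Equiv.ofBijective _ A.dart_bijective
  have heo (d) : e.symm (A.outside d) = .inl d := e.symm_apply_apply (.inl d)
  have hei (d) : e.symm (A.inside d) = .inr d := e.symm_apply_apply (.inr d)
  -- the labels of closed strands
  let K : Type := {_u : Unit // ∃ d, P.exit τi d = none}
  have hK : Nat.card K = P.closedCount τi := by
    unfold LocalPicture.closedCount
    split_ifs with h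
    · have : Unique K := ⟨⟨⟨(), h⟩⟩, fun _ => rfl⟩
      simp
    · have : IsEmpty K := ⟨fun x => h x.2⟩
      simp
  rw [← hK]
  let r : Dart D.Crossing D.Mark → Dart D.Crossing D.Mark → Prop := fun x y => y = D.edge x ∨ y = τ x
  let r' : Dart X M ⊕ Fin n → Dart X M ⊕ Fin n → Prop :=
    fun x y => y = A.portEdge hP x ∨ y = Sum.map τo (P.matching τi) x
  -- a dart of the picture is sent to an end of its strand, or to the label of the closed strand
  let inq (d : Dart P.Crossing P.Mark) : (Dart X M ⊕ Fin n) ⊕ K :=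
    match h : P.exit τi d with
    | some i => .inl (.inr i)
    | none => .inr ⟨(), d, h⟩
  have inq_some {d i} (h : P.exit τi d = some i) : inq d = .inl (.inr i) := by
    simp only [inq]; split <;> simp_all
  have inq_none {d} (h : P.exit τi d = none) (k : K) : inq d = .inr k := by
    simp only [inq]
    split
    · simp_all
    · rfl
  -- outside of the picture every dart is kept
  let q (t : Dart D.Crossing D.Mark) : (Dart X M ⊕ Fin n) ⊕ K :=
    Sum.elim (fun d => .inl (.inl d)) inq (e.symm t)
  have hqo (d) : q (A.outside d) = .inl (.inl d) := by simp only [q, heo]; rfl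
  have hqi (d) : q (A.inside d) = inq d := by simp only [q, hei]; rfl
  have hmatch (i : Fin n) : Quot.mk r' (.inr (P.matching τi i)) = Quot.mk r' (.inr i) :=
    (Quot.sound (r := r') (a := .inr i) (.inr rfl)).symm
  have hcongr {d d'} (h : P.exit τi d' = P.exit τi d ∨
      P.exit τi d' = (P.exit τi d).map (P.matching τi)) :
      Sum.map (Quot.mk r') id (inq d) = Sum.map (Quot.mk r') id (inq d') := by
    rcases hd : P.exit τi d with _ | i
    · have hd' : P.exit τi d' = none := by rcases h with h | h <;> simp [h, hd]
      rw [inq_none hd ⟨(), d, hd⟩, inq_none hd' ⟨(), d, hd⟩]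
    · rw [inq_some hd]
      rcases h with h | h
      · rw [inq_some (h.trans hd)]
      · rw [inq_some (h.trans (by rw [hd]; rfl))]
        simp [hmatch]
  have hport (u) : Sum.map (Quot.mk r') id (q (A.port u)) = .inl (Quot.mk r' u) := by
    rcases u with d | i
    · exact congrArg _ (hqo d)
    · change Sum.map (Quot.mk r') id (q (A.inside (P.ends i))) = _
      rw [hqi]
      rcases hτ.1 i with h | h
      · rw [inq_some h]; rfl
      · rw [inq_some h]; simp [hmatch]
  have hedge (x) : Quot.mk r (D.edge x) = Quot.mk r x := (Quot.sound (r := r) (.inl rfl)).symm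
  have hsmooth (x) : Quot.mk r (τ x) = Quot.mk r x := (Quot.sound (r := r) (.inr rfl)).symm
  have hpartner (d) : Quot.mk r (A.inside (P.partner d)) = Quot.mk r (A.inside d) := by
    by_cases h : P.partner d = d
    · rw [h]
    · rw [← A.edge_inside h, hedge]
  have hstrand {d d'} (h : P.Reaches τi d d') : Quot.mk r (A.inside d') = Quot.mk r (A.inside d) := by
    unfold LocalPicture.Reaches at h
    generalize 7 = k at h
    induction k generalizing d with
    | zero => rw [show d = d' from h]
    | succ k ih =>
      rcases h with rfl | h
      · rfl
      · rw [ih h, hpartner, ← hi, hsmooth]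
  refine card_quot_eq_add r r' A.port (fun k => A.inside k.2.choose) q ?_ hport ?_ ?_ ?_
  · rintro x y (rfl | rfl)
    · obtain ⟨d | d, rfl⟩ := A.dart_bijective.2 x
      · change Sum.map _ _ (q (A.port (.inl d))) = Sum.map _ _ (q (D.edge (A.port (.inl d))))
        rw [A.edge_port hP, hport, hport]
        exact congrArg _ (Quot.sound (.inl rfl))
      · by_cases h : P.partner d = d
        · obtain ⟨i, rfl⟩ := hP.2.2.1 d h
          change Sum.map _ _ (q (A.port (.inr i))) = Sum.map _ _ (q (D.edge (A.port (.inr i))))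
          rw [A.edge_port hP, hport, hport]
          exact congrArg _ (Quot.sound (.inl rfl))
        · change Sum.map _ _ (q (A.inside d)) = Sum.map _ _ (q (D.edge (A.inside d)))
          rw [A.edge_inside h, hqi, hqi]
          exact hcongr (hτ.2.2.1 d)
    · obtain ⟨d | d, rfl⟩ := A.dart_bijective.2 x
      · change Sum.map _ _ (q (A.outside d)) = Sum.map _ _ (q (τ (A.outside d)))
        rw [ho, hqo, hqo]
        exact congrArg Sum.inl (Quot.sound (r := r') (a := .inl d) (.inr rfl))
      · change Sum.map _ _ (q (A.inside d)) = Sum.map _ _ (q (τ (A.inside d)))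
        rw [hi, hqi, hqi]
        exact hcongr (hτ.2.1 d)
  · intro k
    rw [hqi, inq_none k.2.choose_spec]
  · rintro u v (rfl | rfl)
    · rw [← A.edge_port hP, hedge]
    · rcases u with d | i
      · change Quot.mk r (A.outside d) = Quot.mk r (A.outside (τo d))
        rw [← ho, hsmooth]
      · exact (hstrand (P.reaches_matching τi i)).symm
  · intro t
    obtain ⟨d | d, rfl⟩ := A.dart_bijective.2 t
    · change _ = Quot.mk r (Sum.elim _ _ (q (A.outside d)))
      rw [hqo]; rfl
    · change Quot.mk r (A.inside d) = Quot.mk r (Sum.elim _ _ (q (A.inside d)))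
      rw [hqi]
      rcases hd : P.exit τi d with _ | i
      · rw [inq_none hd ⟨(), d, hd⟩]
        have hex : ∃ d, P.exit τi d = none := ⟨d, hd⟩
        change Quot.mk r (A.inside d) = Quot.mk r (A.inside hex.choose)
        rcases hτ.2.2.2 d hd hex.choose hex.choose_spec with h | h
        · exact (hstrand h).symm
        · rw [hstrand h, ← hi, hsmooth]
      · rw [inq_some hd]
        exact (hstrand (P.reaches_of_exit_eq_some hd)).symm

end Placement

/-! ### State sums of local pictures -/

namespace LocalPicture

instance : DecidableEq Triple := fun a b => by
  cases a <;> cases b <;> first | exact isTrue rfl | exact isFalse (by simp)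

instance : Fintype Triple :=
  ⟨{.topMiddle, .topBottom, .middleBottom}, fun x => by cases x <;> simp⟩

instance : crossing.Effective :=
  ⟨inferInstanceAs (DecidableEq Unit), inferInstanceAs (DecidableEq Empty),
    inferInstanceAs (Fintype Unit), inferInstanceAs (Fintype Empty)⟩

instance : switched.Effective :=
  ⟨inferInstanceAs (DecidableEq Unit), inferInstanceAs (DecidableEq Empty),
    inferInstanceAs (Fintype Unit), inferInstanceAs (Fintype Empty)⟩

instance : smoothI.Effective :=
  ⟨inferInstanceAs (DecidableEq Empty), inferInstanceAs (DecidableEq Bool),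
    inferInstanceAs (Fintype Empty), inferInstanceAs (Fintype Bool)⟩

instance : smoothII.Effective :=
  ⟨inferInstanceAs (DecidableEq Empty), inferInstanceAs (DecidableEq Bool),
    inferInstanceAs (Fintype Empty), inferInstanceAs (Fintype Bool)⟩

instance : arc.Effective :=
  ⟨inferInstanceAs (DecidableEq Empty), inferInstanceAs (DecidableEq Unit),
    inferInstanceAs (Fintype Empty), inferInstanceAs (Fintype Unit)⟩

instance (i : ZMod 4) : (kink i).Effective :=
  ⟨inferInstanceAs (DecidableEq Unit), inferInstanceAs (DecidableEq Empty),
    inferInstanceAs (Fintype Unit), inferInstanceAs (Fintype Empty)⟩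

instance : twoArcs.Effective :=
  ⟨inferInstanceAs (DecidableEq Empty), inferInstanceAs (DecidableEq Bool),
    inferInstanceAs (Fintype Empty), inferInstanceAs (Fintype Bool)⟩

instance : bigon.Effective :=
  ⟨inferInstanceAs (DecidableEq Bool), inferInstanceAs (DecidableEq Empty),
    inferInstanceAs (Fintype Bool), inferInstanceAs (Fintype Empty)⟩

instance (s : ℤˣ) : (triangle s).Effective :=
  ⟨inferInstanceAs (DecidableEq Triple), inferInstanceAs (DecidableEq Empty),
    inferInstanceAs (Fintype Triple), inferInstanceAs (Fintype Empty)⟩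

instance (s : ℤˣ) : (triangleMoved s).Effective :=
  ⟨inferInstanceAs (DecidableEq Triple), inferInstanceAs (DecidableEq Empty),
    inferInstanceAs (Fintype Triple), inferInstanceAs (Fintype Empty)⟩

/-- The picture is tidy, and the strands are known for all its states as well as without any
smoothing. -/
def IsRegular {n : ℕ} (P : LocalPicture n) [P.Effective] : Prop :=
  P.IsTidy ∧ P.IsResolved Dart.opp ∧ ∀ s, P.IsResolved (Dart.smooth s)

instance {n : ℕ} (P : LocalPicture n) [P.Effective] : Decidable P.IsRegular := by
  unfold IsRegular; infer_instance

theorem isRegular_crossing : crossing.IsRegular := by decide +kernel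

theorem isRegular_switched : switched.IsRegular := by decide +kernel

theorem isRegular_smoothI : smoothI.IsRegular := by decide +kernel

theorem isRegular_smoothII : smoothII.IsRegular := by decide +kernel

theorem isRegular_arc : arc.IsRegular := by decide +kernel

theorem isRegular_kink : ∀ i, (kink i).IsRegular := by decide +kernel

theorem isRegular_twoArcs : twoArcs.IsRegular := by decide +kernel

theorem isRegular_bigon : bigon.IsRegular := by decide +kernel

theorem isRegular_triangle (s : ℤˣ) : (triangle s).IsRegular := by
  rcases Int.units_eq_one_or s with rfl | rfl <;> decide +kernel

theorem isRegular_triangleMoved (s : ℤˣ) : (triangleMoved s).IsRegular := by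
  rcases Int.units_eq_one_or s with rfl | rfl <;> decide +kernel

variable {R : Type*} [CommRing R] (A B : R) {n : ℕ}

/-- The state sum of a local picture. The contribution of a state is a function `Φ` of the way in
which the strands connect the ends, and of the number of closed strands. -/
noncomputable def bracket (P : LocalPicture n) [P.Effective] (Φ : (Fin n → Fin n) → ℕ → R) : R :=
  stateSum A B P.Crossing fun s => Φ (P.matching (Dart.smooth s)) (P.closedCount (Dart.smooth s))

theorem bracket_of_isEmpty (P : LocalPicture n) [P.Effective] [IsEmpty P.Crossing]
    (Φ : (Fin n → Fin n) → ℕ → R) :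
    P.bracket A B Φ = Φ (P.matching Dart.opp) (P.closedCount Dart.opp) := by
  have : Dart.smooth isEmptyElim = (Dart.opp : Dart P.Crossing P.Mark → _) := by
    ext1 d
    rcases d with ⟨x, _⟩ | _
    · exact isEmptyElim x
    · rfl
  rw [bracket, stateSum_of_isEmpty, this]

theorem bracket_of_unique (P : LocalPicture n) [P.Effective] [Unique P.Crossing]
    (Φ : (Fin n → Fin n) → ℕ → R) {π ρ : Fin n → Fin n} {k l : ℕ}
    (hπ : P.matching (Dart.smooth fun _ => true) = π) (hk : P.closedCount (Dart.smooth fun _ => true) = k)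
    (hρ : P.matching (Dart.smooth fun _ => false) = ρ)
    (hl : P.closedCount (Dart.smooth fun _ => false) = l) :
    P.bracket A B Φ = A * Φ π k + B * Φ ρ l := by
  rw [bracket, stateSum_unique, hπ, hk, hρ, hl]

theorem bracket_crossing (Φ : (Fin 4 → Fin 4) → ℕ → R) :
    crossing.bracket A B Φ = A * Φ ![3, 2, 1, 0] 0 + B * Φ ![1, 0, 3, 2] 0 :=
  haveI : Unique crossing.Crossing := inferInstanceAs (Unique Unit)
  bracket_of_unique A B _ Φ (by decide +kernel) (by decide +kernel) (by decide +kernel) (by decide +kernel)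

theorem bracket_switched (Φ : (Fin 4 → Fin 4) → ℕ → R) :
    switched.bracket A B Φ = A * Φ ![1, 0, 3, 2] 0 + B * Φ ![3, 2, 1, 0] 0 :=
  haveI : Unique switched.Crossing := inferInstanceAs (Unique Unit)
  bracket_of_unique A B _ Φ (by decide +kernel) (by decide +kernel) (by decide +kernel) (by decide +kernel)

theorem bracket_smoothI (Φ : (Fin 4 → Fin 4) → ℕ → R) :
    smoothI.bracket A B Φ = Φ ![3, 2, 1, 0] 0 := by
  have : IsEmpty smoothI.Crossing := inferInstanceAs (IsEmpty Empty)
  rw [bracket_of_isEmpty]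
  congr 1; decide +kernel

theorem bracket_smoothII (Φ : (Fin 4 → Fin 4) → ℕ → R) :
    smoothII.bracket A B Φ = Φ ![1, 0, 3, 2] 0 := by
  have : IsEmpty smoothII.Crossing := inferInstanceAs (IsEmpty Empty)
  rw [bracket_of_isEmpty]
  congr 1; decide +kernel

theorem bracket_arc (Φ : (Fin 2 → Fin 2) → ℕ → R) : arc.bracket A B Φ = Φ ![1, 0] 0 := by
  have : IsEmpty arc.Crossing := inferInstanceAs (IsEmpty Empty)
  rw [bracket_of_isEmpty]
  congr 1; decide +kernel

theorem bracket_twoArcs (Φ : (Fin 4 → Fin 4) → ℕ → R) :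
    twoArcs.bracket A B Φ = Φ ![1, 0, 3, 2] 0 := by
  have : IsEmpty twoArcs.Crossing := inferInstanceAs (IsEmpty Empty)
  rw [bracket_of_isEmpty]
  congr 1; decide +kernel

theorem bracket_kink_of_even (Φ : (Fin 2 → Fin 2) → ℕ → R) {i : ZMod 4} (hi : i = 0 ∨ i = 2) :
    (kink i).bracket A B Φ = A * Φ ![1, 0] 0 + B * Φ ![1, 0] 1 := by
  have : Unique (kink i).Crossing := inferInstanceAs (Unique Unit)
  rcases hi with rfl | rfl <;>
  exact bracket_of_unique A B _ Φ (by decide +kernel) (by decide +kernel) (by decide +kernel)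
    (by decide +kernel)

theorem bracket_kink_of_odd (Φ : (Fin 2 → Fin 2) → ℕ → R) {i : ZMod 4} (hi : i = 1 ∨ i = 3) :
    (kink i).bracket A B Φ = A * Φ ![1, 0] 1 + B * Φ ![1, 0] 0 := by
  have : Unique (kink i).Crossing := inferInstanceAs (Unique Unit)
  rcases hi with rfl | rfl <;>
  exact bracket_of_unique A B _ Φ (by decide +kernel) (by decide +kernel) (by decide +kernel)
    (by decide +kernel)

/-- The four states of the bigon: one of them shows two arcs as before the move, the other three
show the other two arcs, once together with a closed curve. -/
theorem bracket_bigon (Φ : (Fin 4 → Fin 4) → ℕ → R) :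
    bigon.bracket A B Φ = A * B * Φ ![1, 0, 3, 2] 0 + (A * A + B * B) * Φ ![2, 3, 0, 1] 0 +
      A * B * Φ ![2, 3, 0, 1] 1 := by
  let st (x y : Bool) : bigon.Crossing → Bool := fun b : Bool => if b then y else x
  have key : bigon.bracket A B Φ = ∑ x : Bool, ∑ y : Bool,
      (if x then A else B) * (if y then A else B) *
        Φ (bigon.matching (Dart.smooth (st x y))) (bigon.closedCount (Dart.smooth (st x y))) := by
    let e : Bool × Bool ≃ (Bool → Bool) :=
      ⟨fun p b => if b then p.2 else p.1, fun s => (s false, s true), fun p => rfl,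
        fun s => by ext b; cases b <;> rfl⟩
    have := stateSum_eq A B Bool fun s =>
      Φ (bigon.matching (Dart.smooth (X := bigon.Crossing) s))
        (bigon.closedCount (Dart.smooth (X := bigon.Crossing) s))
    rw [← e.sum_comp, Fintype.sum_prod_type] at this
    refine this.trans (Finset.sum_congr rfl fun x _ => Finset.sum_congr rfl fun y _ => ?_)
    rw [Fintype.prod_bool, mul_comm (ite _ _ _)]
    rfl
  have h1 : bigon.matching (Dart.smooth (st true true)) = ![2, 3, 0, 1] ∧
      bigon.closedCount (Dart.smooth (st true true)) = 0 := by decide +kernel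
  have h2 : bigon.matching (Dart.smooth (st true false)) = ![1, 0, 3, 2] ∧
      bigon.closedCount (Dart.smooth (st true false)) = 0 := by decide +kernel
  have h3 : bigon.matching (Dart.smooth (st false true)) = ![2, 3, 0, 1] ∧
      bigon.closedCount (Dart.smooth (st false true)) = 1 := by decide +kernel
  have h4 : bigon.matching (Dart.smooth (st false false)) = ![2, 3, 0, 1] ∧
      bigon.closedCount (Dart.smooth (st false false)) = 0 := by decide +kernel
  rw [key]
  simp only [Fintype.sum_bool, h1, h2, h3, h4, if_true, Bool.false_eq_true, if_false]
  ring

/-- A state of the crossings of three strands. -/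
def tripleState (x y z : Bool) : Triple → Bool
  | .topMiddle => x
  | .topBottom => y
  | .middleBottom => z

theorem stateSum_triple (Ψ : (Triple → Bool) → R) :
    stateSum A B Triple Ψ = ∑ x : Bool, ∑ y : Bool, ∑ z : Bool,
      (if x then A else B) * (if y then A else B) * (if z then A else B) * Ψ (tripleState x y z) := by
  let e : Bool × Bool × Bool ≃ (Triple → Bool) :=
    ⟨fun p => tripleState p.1 p.2.1 p.2.2,
      fun s => (s .topMiddle, s .topBottom, s .middleBottom), fun p => rfl,
      fun s => by ext b; cases b <;> rfl⟩
  rw [stateSum_eq, ← e.sum_comp, Fintype.sum_prod_type]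
  refine Finset.sum_congr rfl fun x _ => ?_
  rw [Fintype.sum_prod_type]
  refine Finset.sum_congr rfl fun y _ => Finset.sum_congr rfl fun z _ => ?_
  congr 1
  have : (Finset.univ : Finset Triple) = {.topMiddle, .topBottom, .middleBottom} := rfl
  rw [this, Finset.prod_insert (by simp), Finset.prod_insert (by simp), Finset.prod_singleton,
    ← mul_assoc]
  rfl

/-- For one smoothing of the crossing of the middle and the bottom strand, the states of the other
two crossings give the same strands before and after the move. For the other smoothing both pictures
show the top strand across an arc, as in `bracket_bigon`. -/
theorem bracket_triangle (s : ℤˣ) : ∃ V : R → R → ((Fin 6 → Fin 6) → ℕ → R) → R, ∃ w : R → R → R,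
    ∀ (A B : R) (Φ : (Fin 6 → Fin 6) → ℕ → R),
      (triangle s).bracket A B Φ = V A B Φ + w A B * (A * B * Φ ![3, 2, 1, 0, 5, 4] 0 +
        (A * A + B * B) * Φ ![1, 0, 3, 2, 5, 4] 0 + A * B * Φ ![1, 0, 3, 2, 5, 4] 1) ∧
      (triangleMoved s).bracket A B Φ = V A B Φ + w A B * (A * B * Φ ![3, 2, 1, 0, 5, 4] 0 +
        (A * A + B * B) * Φ ![5, 2, 1, 4, 3, 0] 0 + A * B * Φ ![5, 2, 1, 4, 3, 0] 1) := by
  let T (s : ℤˣ) (x y z : Bool) := (triangle s).matching (Dart.smooth (tripleState x y z))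
  let T' (s : ℤˣ) (x y z : Bool) := (triangleMoved s).matching (Dart.smooth (tripleState x y z))
  let k (s : ℤˣ) (x y z : Bool) := (triangle s).closedCount (Dart.smooth (tripleState x y z))
  let k' (s : ℤˣ) (x y z : Bool) := (triangleMoved s).closedCount (Dart.smooth (tripleState x y z))
  have e (A B : R) (Φ) : (triangle s).bracket A B Φ = ∑ x : Bool, ∑ y : Bool, ∑ z : Bool,
      (if x then A else B) * (if y then A else B) * (if z then A else B) *
        Φ (T s x y z) (k s x y z) := stateSum_triple A B _
  have e' (A B : R) (Φ) : (triangleMoved s).bracket A B Φ = ∑ x : Bool, ∑ y : Bool, ∑ z : Bool,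
      (if x then A else B) * (if y then A else B) * (if z then A else B) *
        Φ (T' s x y z) (k' s x y z) := stateSum_triple A B _
  simp only [e, e', Fintype.sum_bool, if_true, Bool.false_eq_true, if_false]
  rcases Int.units_eq_one_or s with rfl | rfl
  · have h : ∀ x y, T 1 x y true = T' 1 y x true ∧ k 1 x y true = 0 ∧ k' 1 x y true = 0 := by
      decide +kernel
    have h1 : T 1 true true false = ![1, 0, 3, 2, 5, 4] ∧ T 1 true false false = ![3, 2, 1, 0, 5, 4] ∧
        T 1 false true false = ![1, 0, 3, 2, 5, 4] ∧ T 1 false false false = ![1, 0, 3, 2, 5, 4] ∧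
        k 1 true true false = 0 ∧ k 1 true false false = 0 ∧ k 1 false true false = 1 ∧
        k 1 false false false = 0 := by decide +kernel
    have h2 : T' 1 true true false = ![5, 2, 1, 4, 3, 0] ∧ T' 1 true false false = ![3, 2, 1, 0, 5, 4] ∧
        T' 1 false true false = ![5, 2, 1, 4, 3, 0] ∧ T' 1 false false false = ![5, 2, 1, 4, 3, 0] ∧
        k' 1 true true false = 0 ∧ k' 1 true false false = 0 ∧ k' 1 false true false = 1 ∧
        k' 1 false false false = 0 := by decide +kernel
    refine ⟨fun A B Φ => A * (A * A * Φ (T' 1 true true true) 0 + A * B * Φ (T' 1 true false true) 0 +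
      A * B * Φ (T' 1 false true true) 0 + B * B * Φ (T' 1 false false true) 0), fun A B => B,
      fun A B Φ => ?_⟩
    simp only [h, h1, h2]
    constructor <;> ring
  · have h : ∀ x y, T (-1) x y false = T' (-1) y x false ∧ k (-1) x y false = 0 ∧
        k' (-1) x y false = 0 := by
      decide +kernel
    have h1 : T (-1) true true true = ![1, 0, 3, 2, 5, 4] ∧ T (-1) true false true = ![1, 0, 3, 2, 5, 4] ∧
        T (-1) false true true = ![3, 2, 1, 0, 5, 4] ∧ T (-1) false false true = ![1, 0, 3, 2, 5, 4] ∧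
        k (-1) true true true = 0 ∧ k (-1) true false true = 1 ∧ k (-1) false true true = 0 ∧
        k (-1) false false true = 0 := by decide +kernel
    have h2 : T' (-1) true true true = ![5, 2, 1, 4, 3, 0] ∧
        T' (-1) true false true = ![5, 2, 1, 4, 3, 0] ∧
        T' (-1) false true true = ![3, 2, 1, 0, 5, 4] ∧ T' (-1) false false true = ![5, 2, 1, 4, 3, 0] ∧
        k' (-1) true true true = 0 ∧ k' (-1) true false true = 1 ∧ k' (-1) false true true = 0 ∧
        k' (-1) false false true = 0 := by decide +kernel
    refine ⟨fun A B Φ => B * (A * A * Φ (T' (-1) true true false) 0 +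
      A * B * Φ (T' (-1) true false false) 0 + A * B * Φ (T' (-1) false true false) 0 +
      B * B * Φ (T' (-1) false false false) 0), fun A B => A, fun A B Φ => ?_⟩
    simp only [h, h1, h2]
    constructor <;> ring

end LocalPicture

namespace Placement

variable {R : Type*} [CommRing R] (A B : R) (v : ℕ → R) {D : SurfaceDiagram} {n : ℕ}
  {P : LocalPicture n} {X M : Type}

theorem bracket_eq [Finite X] (a : Placement D P X M) [P.Effective] (hP : P.IsRegular) :
    D.bracket A B v = stateSum A B X fun s =>
      P.bracket A B fun π k => v (loopCount (a.portEdge hP.1) (Sum.map (Dart.smooth s) π) + k) := by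
  rw [SurfaceDiagram.bracket, stateSum_equiv A B a.crossing.symm, stateSum_sum]
  congr 1
  ext1 s
  unfold LocalPicture.bracket
  congr 1
  ext1 t
  congr 1
  refine a.loopCount_eq hP.1 ?_ ?_ (hP.2.2 t) <;>
  · rintro (⟨x, i⟩ | ⟨m, j⟩) <;> simp [outside, inside, Dart.map, Dart.smooth]

theorem componentNumber_eq (a : Placement D P X M) [P.Effective] (hP : P.IsRegular) :
    D.componentNumber =
      loopCount (a.portEdge hP.1) (Sum.map Dart.opp (P.matching Dart.opp)) + P.closedCount Dart.opp :=
  a.loopCount_eq hP.1 (by rintro (⟨x, i⟩ | ⟨m, j⟩) <;> rfl)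
    (by rintro (⟨x, i⟩ | ⟨m, j⟩) <;> rfl) hP.2.1

end Placement

/-! ### The state sum under local changes -/

/-- The checkerboard colours at a crossing alternate. -/
theorem Dart.apply_inl_eq {X M : Type} {σ : Dart X M → Bool} (hσ : ∀ d, σ d.rot = !σ d) (x : X)
    (i : ZMod 4) : σ (.inl (x, i)) = (σ (.inl (x, 0)) ^^ i.val.bodd) := by
  have h0 : σ (.inl (x, 1)) = !σ (.inl (x, 0)) := hσ (.inl (x, 0))
  have h1 : σ (.inl (x, 2)) = !σ (.inl (x, 1)) := hσ (.inl (x, 1))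
  have h2 : σ (.inl (x, 3)) = !σ (.inl (x, 2)) := hσ (.inl (x, 2))
  have : i = 0 ∨ i = 1 ∨ i = 2 ∨ i = 3 := by revert i; decide
  rcases this with rfl | rfl | rfl | rfl
  · rw [show (0 : ZMod 4).val.bodd = false from rfl, Bool.xor_false]
  · rw [show (1 : ZMod 4).val.bodd = true from rfl, Bool.xor_true, h0]
  · rw [show (2 : ZMod 4).val.bodd = false from rfl, Bool.xor_false, h1, h0, Bool.not_not]
  · rw [show (3 : ZMod 4).val.bodd = true from rfl, Bool.xor_true, h2, h1, h0, Bool.not_not]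

namespace Placement

variable {D D' : SurfaceDiagram} {n : ℕ} {P : LocalPicture n} {X M : Type}

open LocalPicture

theorem apply_inside (a : Placement D P X M) {σ : Dart D.Crossing D.Mark → Bool}
    (hσ : ∀ d, σ d.rot = !σ d) (x : P.Crossing) (i : ZMod 4) :
    σ (a.inside (.inl (x, i))) = (σ (a.inside (.inl (x, 0))) ^^ i.val.bodd) :=
  Dart.apply_inl_eq hσ _ _

/-- The checkerboard colours at the ends of a bigon. -/
theorem apply_port_bigon (a : Placement D bigon X M) {σ : Dart D.Crossing D.Mark → Bool}
    (hedge : ∀ d, σ (D.edge d) = !σ d) (hσ : ∀ d, σ d.rot = !σ d) (i : Fin 4) :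
    σ (a.port (.inr i)) = (σ (a.port (.inr 0)) ^^ ![false, true, true, false] i) := by
  let g (x : Bool) (k : ZMod 4) : Bool := σ (a.inside (.inl (x, k)))
  have hg (x k) : g x k = (g x 0 ^^ k.val.bodd) := a.apply_inside hσ x k
  have h1 : (!g false 2) = g true 2 := by
    have := a.inner (.inl (false, 2), .inl (true, 2)) (.head _)
    exact (hedge (a.inside (.inl (false, 2)))).symm.trans (congrArg σ this)
  rw [hg, hg true, show (2 : ZMod 4).val.bodd = false from rfl, Bool.xor_false, Bool.xor_false] at h1
  change _ = (g false 0 ^^ _)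
  fin_cases i
  · exact (Bool.xor_false _).symm
  · exact h1.symm.trans (Bool.xor_true _).symm
  · exact hg false 1
  · refine (hg true 3).trans ?_
    rw [← h1, show (3 : ZMod 4).val.bodd = true from rfl]
    simp

/-- The checkerboard colours at the ends of a triangle. -/
theorem apply_port_triangle {s : ℤˣ} (a : Placement D (triangle s) X M)
    {σ : Dart D.Crossing D.Mark → Bool} (hedge : ∀ d, σ (D.edge d) = !σ d)
    (hσ : ∀ d, σ d.rot = !σ d) (i : Fin 6) :
    σ (a.port (.inr i)) = (σ (a.port (.inr 0)) ^^ ![false, true, false, true, false, true] i) := by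
  let g (x : Triple) (k : ZMod 4) : Bool := σ (a.inside (.inl (x, k)))
  have hg (x k) : g x k = (g x 0 ^^ k.val.bodd) := a.apply_inside hσ x k
  have h1 : (!g .topMiddle ((s : ℤ) * 0)) = g .topBottom ((s : ℤ) * 2) := by
    have := a.inner (.inl (.topMiddle, (s : ℤ) * 0), .inl (.topBottom, (s : ℤ) * 2)) (.head _)
    exact (hedge (a.inside (.inl (.topMiddle, (s : ℤ) * 0)))).symm.trans (congrArg σ this)
  have h2 : (!g .topMiddle ((s : ℤ) * 1)) = g .middleBottom ((s : ℤ) * 2) := by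
    have := a.inner (.inl (.topMiddle, (s : ℤ) * 1), .inl (.middleBottom, (s : ℤ) * 2))
      (.tail _ (.head _))
    exact (hedge (a.inside (.inl (.topMiddle, (s : ℤ) * 1)))).symm.trans (congrArg σ this)
  rw [hg, hg _ (_ * 2)] at h1 h2
  have p0 : (((s : ℤ) : ZMod 4) * 0).val.bodd = false := by
    rcases Int.units_eq_one_or s with rfl | rfl <;> rfl
  have p1 : (((s : ℤ) : ZMod 4) * 1).val.bodd = true := by
    rcases Int.units_eq_one_or s with rfl | rfl <;> rfl
  have p2 : (((s : ℤ) : ZMod 4) * 2).val.bodd = false := by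
    rcases Int.units_eq_one_or s with rfl | rfl <;> rfl
  have p3 : (((s : ℤ) : ZMod 4) * 3).val.bodd = true := by
    rcases Int.units_eq_one_or s with rfl | rfl <;> rfl
  simp only [p0, p1, p2, Bool.xor_false, Bool.xor_true, Bool.not_not] at h1 h2
  have h0 : σ (a.port (.inr 0)) = g .topMiddle 0 := by
    refine (hg .topMiddle _).trans ?_
    rw [p2, Bool.xor_false]
  rw [h0]
  fin_cases i
  · exact h0.trans (Bool.xor_false _).symm
  · exact (hg .topMiddle _).trans (by rw [p3]; rfl)
  · exact (hg .topBottom _).trans (by rw [p3, ← h1]; simp)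
  · exact (hg .topBottom _).trans (by rw [p0, ← h1]; simp)
  · exact (hg .middleBottom _).trans (by rw [p0, ← h2]; simp)
  · exact (hg .middleBottom _).trans (by rw [p1, ← h2]; simp)

/-- In a planar diagram, a saddle move at the ends of a local picture changes the number of closed
curves by exactly one. -/
theorem loopCount_saddle [Finite X] [Finite M] (a : Placement D P X M) [P.Effective] (hP : P.IsTidy)
    {σ : Dart D.Crossing D.Mark → Bool} (hedge : ∀ d, σ (D.edge d) = !σ d)
    (hσ : ∀ d, σ d.rot = !σ d) {χ : Fin n → Bool} {e : Bool}
    (hχ : ∀ i, σ (a.port (.inr i)) = (e ^^ χ i)) (s : X → Bool) {π π' : Fin n → Fin n} (i j : Fin n)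
    (hπ : (∀ k, π (π k) = k) ∧ (∀ k, χ (π k) = !χ k) ∧ i ≠ j ∧ χ i = χ j)
    (hπ' : π' i = π j ∧ π' j = π i ∧ π' (π i) = j ∧ π' (π j) = i ∧
      ∀ k, k ≠ i → k ≠ j → k ≠ π i → k ≠ π j → π' k = π k) :
    loopCount (a.portEdge hP) (Sum.map (Dart.smooth s) π) =
        loopCount (a.portEdge hP) (Sum.map (Dart.smooth s) π') + 1 ∨
      loopCount (a.portEdge hP) (Sum.map (Dart.smooth s) π') =
        loopCount (a.portEdge hP) (Sum.map (Dart.smooth s) π) + 1 := by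
  refine _root_.loopCount_saddle (σ := fun u => σ (a.port u)) (p := .inr i) (q := .inr j)
    (a.portEdge_portEdge hP) ?_ (fun u => by rw [← a.edge_port, hedge]) ?_ (by simpa using hπ.2.2.1)
    (by simp only [hχ, hπ.2.2.2]) (congrArg Sum.inr hπ'.1) (congrArg Sum.inr hπ'.2.1)
    (congrArg Sum.inr hπ'.2.2.1) (congrArg Sum.inr hπ'.2.2.2.1) ?_
  · rintro (d | k)
    · exact congrArg Sum.inl (Dart.smooth_smooth s d)
    · exact congrArg Sum.inr (hπ.1 k)
  · rintro (d | k)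
    · exact Dart.apply_smooth (σ := fun d => σ (a.outside d))
        (fun d => by rw [← hσ]; rcases d with d | d <;> rfl) s d
    · simp only [Sum.map_inr, hχ, hπ.2.1, Bool.xor_not]
  · rintro (d | k) h1 h2 h3 h4
    · rfl
    · simp only [Sum.map_inr, ne_eq, Sum.inr.injEq] at h1 h2 h3 h4 ⊢
      exact hπ'.2.2.2.2 k h1 h2 h3 h4

variable {R : Type*} [CommRing R] {A B : R} {v : ℕ → R}

theorem bracket_crossing {H I II : SurfaceDiagram} {a : Placement H LocalPicture.crossing X M}
    {b : Placement I smoothI X M} {c : Placement II smoothII X M} (hab : a.SameOutside b)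
    (hac : a.SameOutside c) : H.bracket A B v = A * I.bracket A B v + B * II.bracket A B v := by
  have := a.finite_outside.1
  rw [a.bracket_eq A B v isRegular_crossing, b.bracket_eq A B v isRegular_smoothI,
    c.bracket_eq A B v isRegular_smoothII, ← hab.portEdge_eq isRegular_crossing.1 isRegular_smoothI.1,
    ← hac.portEdge_eq isRegular_crossing.1 isRegular_smoothII.1, mul_stateSum, mul_stateSum,
    ← stateSum_add]
  simp only [LocalPicture.bracket_crossing, LocalPicture.bracket_smoothI,
    LocalPicture.bracket_smoothII]

/-- The condition on `α` has the form of the relation for a negative kink. -/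
theorem bracket_kink_of_even {i : ZMod 4} {α : R} {a : Placement D arc X M}
    {b : Placement D' (kink i) X M} (hab : a.SameOutside b) (hi : i = 0 ∨ i = 2)
    (hα : ∀ n > 0, B * v (n + 1) + A * v n = α * v n) : D'.bracket A B v = α * D.bracket A B v := by
  have := a.finite_outside.1
  have := a.finite_outside.2
  rw [a.bracket_eq A B v isRegular_arc, b.bracket_eq A B v (isRegular_kink i),
    ← hab.portEdge_eq isRegular_arc.1 (isRegular_kink i).1, mul_stateSum]
  congr 1
  ext1 s
  rw [LocalPicture.bracket_kink_of_even A B _ hi, LocalPicture.bracket_arc, add_zero,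
    ← hα _ (loopCount_pos _ _), add_comm]

/-- The condition on `α` has the form of the relation for a positive kink. -/
theorem bracket_kink_of_odd {i : ZMod 4} {α : R} {a : Placement D arc X M}
    {b : Placement D' (kink i) X M} (hab : a.SameOutside b) (hi : i = 1 ∨ i = 3)
    (hα : ∀ n > 0, A * v (n + 1) + B * v n = α * v n) : D'.bracket A B v = α * D.bracket A B v := by
  have := a.finite_outside.1
  have := a.finite_outside.2
  rw [a.bracket_eq A B v isRegular_arc, b.bracket_eq A B v (isRegular_kink i),
    ← hab.portEdge_eq isRegular_arc.1 (isRegular_kink i).1, mul_stateSum]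
  congr 1
  ext1 s
  rw [LocalPicture.bracket_kink_of_odd A B _ hi, LocalPicture.bracket_arc, add_zero,
    ← hα _ (loopCount_pos _ _)]

/-- In every state, the two kinds of arcs that the smoothings of a bigon leave differ by a saddle
move, so that the numbers of closed curves are related as the condition on `ρ` demands. -/
theorem bracket_bigon {ρ : R} {a : Placement D twoArcs X M} {b : Placement D' bigon X M}
    (hab : a.SameOutside b) (hD' : D'.IsPlanar)
    (hρ : ∀ n > 0, ∀ m > 0, n = m + 1 ∨ m = n + 1 →
      A * B * v n + (A * A + B * B) * v m + A * B * v (m + 1) = ρ * v n) :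
    D'.bracket A B v = ρ * D.bracket A B v := by
  have := a.finite_outside.1
  have := a.finite_outside.2
  obtain ⟨σ, hedge, hσ⟩ := hD'.exists_checkerboard
  rw [a.bracket_eq A B v isRegular_twoArcs, b.bracket_eq A B v isRegular_bigon,
    hab.portEdge_eq isRegular_twoArcs.1 isRegular_bigon.1, mul_stateSum]
  congr 1
  ext1 s
  rw [LocalPicture.bracket_bigon, LocalPicture.bracket_twoArcs, add_zero, add_zero]
  exact hρ _ (loopCount_pos _ _) _ (loopCount_pos _ _)
    (b.loopCount_saddle isRegular_bigon.1 hedge hσ (b.apply_port_bigon hedge hσ) s 0 3 (by decide)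
      (by decide))

/-- A Reidemeister III move: the states in which the two pictures differ are both equal, by the
identity of `bracket_bigon`, to `ρ` times the same third one. -/
theorem bracket_triangle {s : ℤˣ} {ρ : R} {a : Placement D (triangle s) X M}
    {b : Placement D' (triangleMoved s) X M} (hab : a.SameOutside b) (hD : D.IsPlanar)
    (hρ : ∀ n > 0, ∀ m > 0, n = m + 1 ∨ m = n + 1 →
      A * B * v n + (A * A + B * B) * v m + A * B * v (m + 1) = ρ * v n) :
    D.bracket A B v = D'.bracket A B v := by
  have := a.finite_outside.1
  have := a.finite_outside.2
  obtain ⟨σ, hedge, hσ⟩ := hD.exists_checkerboard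
  rw [a.bracket_eq A B v (isRegular_triangle s), b.bracket_eq A B v (isRegular_triangleMoved s),
    ← hab.portEdge_eq (isRegular_triangle s).1 (isRegular_triangleMoved s).1]
  congr 1
  ext1 t
  obtain ⟨V, w, hV⟩ := LocalPicture.bracket_triangle (R := R) s
  rw [(hV _ _ _).1, (hV _ _ _).2, add_zero, add_zero, add_zero]
  rw [hρ _ (loopCount_pos _ _) _ (loopCount_pos _ _)
      (a.loopCount_saddle (isRegular_triangle s).1 hedge hσ (a.apply_port_triangle hedge hσ) t 0 2
        (by decide) (by decide)),
    hρ _ (loopCount_pos _ _) _ (loopCount_pos _ _)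
      (a.loopCount_saddle (isRegular_triangle s).1 hedge hσ (a.apply_port_triangle hedge hσ) t 0 4
        (by decide) (by decide))]

end Placement

/-! ### Isomorphisms and subdivisions -/

namespace DiagramIso

variable {D D' : SurfaceDiagram}

theorem rot_rot_eq_iff {X M : Type} (d : Dart X M) : d.rot.rot = d ↔ d.isRight := by
  rcases d with ⟨x, i⟩ | ⟨m, j⟩
  · have : i + 1 + 1 ≠ i := by revert i; decide
    simp [Dart.rot, this]
  · have : j + 1 + 1 = j := by revert j; decide
    simp [Dart.rot, this]

/-- An isomorphism maps crossings to crossings and marks to marks. At each crossing it is the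
identity or a half turn. -/
theorem exists_crossing (φ : DiagramIso D D') :
    ∃ (κ : D.Crossing ≃ D'.Crossing) (t : D.Crossing → ZMod 4),
      (∀ x, t x = 0 ∨ t x = 2) ∧ (∀ x i, φ.dart (.inl (x, i)) = .inl (κ x, i + t x)) ∧
        ∀ m j, ∃ m' j', φ.dart (.inr (m, j)) = .inr (m', j') := by
  have hright (d) : (φ.dart d).isRight ↔ d.isRight := by
    rw [← rot_rot_eq_iff, ← rot_rot_eq_iff, ← φ.rot, ← φ.rot, φ.dart.apply_eq_iff_eq]
  have h0 (x : D.Crossing) : ∃ y t, (t = 0 ∨ t = 2) ∧ φ.dart (.inl (x, 0)) = .inl (y, t) := by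
    rcases h : φ.dart (.inl (x, 0)) with ⟨y, t⟩ | ⟨m, j⟩
    · have := φ.isOver (.inl (x, 0))
      rw [h] at this
      exact ⟨y, t, this.2 (.inl rfl), rfl⟩
    · have := hright (.inl (x, 0))
      rw [h] at this
      simp at this
  choose κ t ht hκ using h0
  have hi (x : D.Crossing) (i : ZMod 4) : φ.dart (.inl (x, i)) = .inl (κ x, i + t x) := by
    have s0 := hκ x
    have s1 := φ.rot (.inl (x, 0))
    have s2 := φ.rot (.inl (x, 1))
    have s3 := φ.rot (.inl (x, 2))
    change φ.dart (.inl (x, 1)) = _ at s1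
    change φ.dart (.inl (x, 2)) = _ at s2
    change φ.dart (.inl (x, 3)) = _ at s3
    rw [s0] at s1
    rw [s1] at s2
    rw [s2] at s3
    have : i = 0 ∨ i = 1 ∨ i = 2 ∨ i = 3 := by revert i; decide
    rcases this with rfl | rfl | rfl | rfl
    · rw [s0, zero_add]
    · rw [s1]; simp only [Dart.rot]; congr 2; ring
    · rw [s2]; simp only [Dart.rot]; congr 2; ring
    · rw [s3]; simp only [Dart.rot]; congr 2; ring
  refine ⟨Equiv.ofBijective κ ⟨fun x x' h => ?_, fun y => ?_⟩, t, ht, hi, fun m j => ?_⟩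
  · have h1 : φ.dart (.inl (x, - t x)) = φ.dart (.inl (x', - t x')) := by
      rw [hi, hi, h]; simp
    simpa using congrArg (Sum.map Prod.fst Prod.fst) (φ.dart.injective h1)
  · rcases h : φ.dart.symm (.inl (y, 0)) with ⟨x, i⟩ | ⟨m, j⟩
    · have := φ.dart.apply_symm_apply (.inl (y, 0))
      rw [h, hi] at this
      exact ⟨x, by simpa using congrArg (Sum.map Prod.fst Prod.fst) this⟩
    · have e : φ.dart (.inr (m, j)) = .inl (y, 0) := by rw [← h, φ.dart.apply_symm_apply]
      have := hright (.inr (m, j))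
      rw [e] at this
      simp at this
  · rcases h : φ.dart (.inr (m, j)) with ⟨y, t⟩ | ⟨m', j'⟩
    · have := hright (.inr (m, j))
      rw [h] at this
      simp at this
    · exact ⟨m', j', rfl⟩

theorem bracket_eq {R : Type*} [CommRing R] (A B : R) (v : ℕ → R) (φ : DiagramIso D D') :
    D.bracket A B v = D'.bracket A B v := by
  obtain ⟨κ, t, ht, hκ, hm⟩ := φ.exists_crossing
  unfold SurfaceDiagram.bracket
  rw [stateSum_equiv A B κ.symm]
  congr 1
  ext1 s
  congr 1
  refine loopCount_congr φ.dart φ.edge ?_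
  rintro (⟨x, i⟩ | ⟨m, j⟩)
  · simp only [Dart.smooth, hκ, Function.comp_apply, Equiv.symm_apply_apply]
    have : t x = - t x := by rcases ht x with h | h <;> rw [h] <;> rfl
    split_ifs
    · rw [show 3 - i + t x = 3 - (i + t x) by rw [sub_add_eq_sub_sub, sub_eq_add_neg _ (t x), ← this]]
    · rw [show 1 - i + t x = 1 - (i + t x) by rw [sub_add_eq_sub_sub, sub_eq_add_neg _ (t x), ← this]]
  · obtain ⟨m', j', h⟩ := hm m j
    have := φ.rot (.inr (m, j))
    rw [h] at this ⊢
    exact this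

theorem componentNumber_eq (φ : DiagramIso D D') : D.componentNumber = D'.componentNumber := by
  obtain ⟨κ, t, ht, hκ, hm⟩ := φ.exists_crossing
  refine loopCount_congr φ.dart φ.edge ?_
  rintro (⟨x, i⟩ | ⟨m, j⟩)
  · simp only [Dart.opp, hκ, add_right_comm]
  · obtain ⟨m', j', h⟩ := hm m j
    have := φ.rot (.inr (m, j))
    rw [h] at this ⊢
    exact this

theorem crossingNumber_eq (φ : DiagramIso D D') : D.crossingNumber = D'.crossingNumber :=
  Nat.card_congr φ.exists_crossing.choose

theorem writhe_eq {D D' : OrientedDiagram} (φ : DiagramIso D.toSurfaceDiagram D'.toSurfaceDiagram)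
    (hout : ∀ d, D'.out (φ.dart d) = D.out d) : D.writhe = D'.writhe := by
  obtain ⟨κ, t, ht, hκ, -⟩ := φ.exists_crossing
  refine finsum_eq_of_bijective κ κ.bijective fun x => ?_
  have h0 := hout (.inl (x, 0))
  have h1 := hout (.inl (x, 1))
  rw [hκ] at h0 h1
  unfold OrientedDiagram.sign
  rw [← h0, ← h1]
  rcases ht x with h | h
  · rw [h, add_zero, add_zero]
  · have e0 := D'.out_opp (.inl (κ x, 0))
    have e1 := D'.out_opp (.inl (κ x, 1))
    simp only [Dart.opp] at e0 e1
    simp only [h, e0, e1, Bool.not_inj_iff]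

end DiagramIso

namespace Subdivision

variable {D D' : SurfaceDiagram}

/-- A new mark lengthens a closed curve and changes nothing else. -/
theorem loopCount_eq (S : Subdivision D D') {τ : Dart D.Crossing D.Mark → Dart D.Crossing D.Mark}
    {τ' : Dart D'.Crossing D'.Mark → Dart D'.Crossing D'.Mark}
    (hτ : ∀ d, τ' (d.map S.crossing (S.mark ∘ some)) = (τ d).map S.crossing (S.mark ∘ some))
    (hnew : ∀ j, τ' (.inr (S.mark none, j)) = .inr (S.mark none, j + 1)) :
    loopCount D.edge τ = loopCount D'.edge τ' := by
  let p : Dart D.Crossing D.Mark → Dart D'.Crossing D'.Mark := Dart.map S.crossing (S.mark ∘ some)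
  let new (j : ZMod 2) : Dart D'.Crossing D'.Mark := .inr (S.mark none, j)
  -- both darts of the new mark are sent to the dart on whose edge it lies
  let q : Dart D'.Crossing D'.Mark → Dart D.Crossing D.Mark
    | .inl (x, i) => .inl (S.crossing.symm x, i)
    | .inr (m, j) => (S.mark.symm m).elim S.base fun m => .inr (m, j)
  have hqp (d) : q (p d) = d := by rcases d with ⟨x, i⟩ | ⟨m, j⟩ <;> simp [p, q, Dart.map]
  have hqn (j) : q (new j) = S.base := by simp [q, new]
  have hcases (d : Dart D'.Crossing D'.Mark) : (∃ d₀, d = p d₀) ∨ ∃ j, d = new j := by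
    rcases d with ⟨x, i⟩ | ⟨m, j⟩
    · exact .inl ⟨.inl (S.crossing.symm x, i), by simp [p, Dart.map]⟩
    · obtain ⟨_ | m, rfl⟩ := S.mark.surjective m
      · exact .inr ⟨j, rfl⟩
      · exact .inl ⟨.inr (m, j), rfl⟩
  have e0 : D'.edge (p S.base) = new 0 := S.edge_base
  have e1 : D'.edge (p (D.edge S.base)) = new 1 := S.edge_edge_base
  have e0' : D'.edge (new 0) = p S.base := by rw [← e0, D'.edge_edge]
  have e1' : D'.edge (new 1) = p (D.edge S.base) := by rw [← e1, D'.edge_edge]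
  let r : Dart D.Crossing D.Mark → Dart D.Crossing D.Mark → Prop := fun x y => y = D.edge x ∨ y = τ x
  let r' : Dart D'.Crossing D'.Mark → Dart D'.Crossing D'.Mark → Prop :=
    fun x y => y = D'.edge x ∨ y = τ' x
  have he (d) : Quot.mk r (D.edge d) = Quot.mk r d := (Quot.sound (r := r) (.inl rfl)).symm
  have hs (d) : Quot.mk r (τ d) = Quot.mk r d := (Quot.sound (r := r) (.inr rfl)).symm
  have he' (d) : Quot.mk r' (D'.edge d) = Quot.mk r' d := (Quot.sound (r := r') (.inl rfl)).symm
  have hs' (d) : Quot.mk r' (τ' d) = Quot.mk r' d := (Quot.sound (r := r') (.inr rfl)).symm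
  have hbase : Quot.mk r' (p S.base) = Quot.mk r' (new 0) := by rw [← e0', he']
  have hbase' : Quot.mk r' (p (D.edge S.base)) = Quot.mk r' (new 0) := by
    rw [← e1', he', ← hs' (new 0), hnew]; rfl
  have hj (j : ZMod 2) : j = 0 ∨ j = 1 := by revert j; decide
  have := card_quot_eq_add (K := Empty) r' r p Empty.elim (fun d => .inl (q d)) ?_ ?_ (fun j => j.elim)
    ?_ ?_
  · simpa [loopCount, r, r'] using this.symm
  · intro x y hxy
    refine congrArg Sum.inl ?_
    rcases hcases x with ⟨d, rfl⟩ | ⟨j, rfl⟩ <;> rcases hxy with rfl | rfl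
    · by_cases h0 : d = S.base
      · rw [h0, e0, hqp, hqn]
      by_cases h1 : d = D.edge S.base
      · rw [h1, e1, hqp, hqn, he]
      rw [S.edge_other d h0 h1, hqp, ← he d]
      exact congrArg _ (hqp _).symm
    · rw [hτ, hqp, ← hs d]
      exact congrArg _ (hqp _).symm
    · rcases hj j with rfl | rfl
      · rw [e0', hqp, hqn]
      · rw [e1', hqp, hqn, he]
    · rw [hnew, hqn]
      exact congrArg _ (hqn _).symm
  · intro u
    exact congrArg Sum.inl (congrArg _ (hqp u))
  · rintro u v (rfl | rfl)
    · by_cases h0 : u = S.base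
      · rw [h0, hbase, hbase']
      by_cases h1 : u = D.edge S.base
      · rw [h1, D.edge_edge, hbase, hbase']
      rw [← he' (p u)]
      exact congrArg _ (S.edge_other u h0 h1)
    · rw [← hs' (p u)]
      exact congrArg _ (hτ u)
  · intro t
    rcases hcases t with ⟨d, rfl⟩ | ⟨j, rfl⟩
    · simp only [Sum.elim_inl, hqp]
    · simp only [Sum.elim_inl, hqn, hbase]
      rcases hj j with rfl | rfl
      · rfl
      · rw [← hs' (new 0)]
        exact congrArg _ (hnew 0).symm

theorem bracket_eq {R : Type*} [CommRing R] (A B : R) (v : ℕ → R) (S : Subdivision D D') :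
    D.bracket A B v = D'.bracket A B v := by
  unfold SurfaceDiagram.bracket
  rw [stateSum_equiv A B S.crossing.symm]
  congr 1
  ext1 s
  congr 1
  refine S.loopCount_eq ?_ fun j => rfl
  rintro (⟨x, i⟩ | ⟨m, j⟩) <;> simp [Dart.smooth, Dart.map]

theorem componentNumber_eq (S : Subdivision D D') : D.componentNumber = D'.componentNumber :=
  S.loopCount_eq (by rintro (⟨x, i⟩ | ⟨m, j⟩) <;> rfl) fun j => rfl

theorem crossingNumber_eq (S : Subdivision D D') : D.crossingNumber = D'.crossingNumber :=
  Nat.card_congr S.crossing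

theorem writhe_eq {D D' : OrientedDiagram} (S : Subdivision D.toSurfaceDiagram D'.toSurfaceDiagram)
    (hout : ∀ d, D'.out (d.map S.crossing (S.mark ∘ some)) = D.out d) : D.writhe = D'.writhe :=
  finsum_eq_of_bijective S.crossing S.crossing.bijective fun x => by
    unfold OrientedDiagram.sign
    rw [← hout (.inl (x, 0)), ← hout (.inl (x, 1))]
    rfl

end Subdivision

/-! ### The writhe under local changes -/

namespace Placement

open LocalPicture

theorem crossingNumber_eq {D : SurfaceDiagram} {n : ℕ} {P : LocalPicture n} {X M : Type}
    (a : Placement D P X M) [P.Effective] :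
    D.crossingNumber = Nat.card X + Nat.card P.Crossing := by
  have := a.finite_outside.1
  rw [SurfaceDiagram.crossingNumber, ← Nat.card_congr a.crossing, Nat.card_sum]

variable {D D' : OrientedDiagram} {n : ℕ} {P P' : LocalPicture n} {X M : Type}

/-- The crossings outside keep their signs. -/
theorem writhe_sub_eq [P.Effective] [P'.Effective] (a : Placement D.toSurfaceDiagram P X M)
    (b : Placement D'.toSurfaceDiagram P' X M) (hout : ∀ u, D.out (a.port u) = D'.out (b.port u)) :
    D'.writhe - D.writhe = ∑ y : P'.Crossing, D'.sign (b.crossing (.inr y)) -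
      ∑ y : P.Crossing, D.sign (a.crossing (.inr y)) := by
  have := a.finite_outside.1
  have := Fintype.ofFinite X
  have h (D : OrientedDiagram) {P : LocalPicture n} [P.Effective]
      (a : Placement D.toSurfaceDiagram P X M) :
      D.writhe = ∑ x : X, D.sign (a.crossing (.inl x)) +
        ∑ y : P.Crossing, D.sign (a.crossing (.inr y)) := by
    rw [OrientedDiagram.writhe, ← finsum_comp_equiv a.crossing, finsum_eq_sum_of_fintype,
      Fintype.sum_sum_type]
  have hx (x : X) : D.sign (a.crossing (.inl x)) = D'.sign (b.crossing (.inl x)) := by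
    have h0 := hout (.inl (.inl (x, 0)))
    have h1 := hout (.inl (.inl (x, 1)))
    simp only [port, Dart.map, Function.comp_apply] at h0 h1
    rw [OrientedDiagram.sign, h0, h1]; rfl
  rw [h D a, h D' b, Finset.sum_congr rfl fun x _ => hx x]
  ring

theorem out_inside_add_two (a : Placement D.toSurfaceDiagram P X M) (x : P.Crossing) (i : ZMod 4) :
    D.out (a.inside (.inl (x, i + 2))) = !D.out (a.inside (.inl (x, i))) :=
  D.out_opp (a.inside (.inl (x, i)))

theorem out_inner (a : Placement D.toSurfaceDiagram P X M) {d d' : Dart P.Crossing P.Mark}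
    (h : (d, d') ∈ P.inner) : D.out (a.inside d') = !D.out (a.inside d) := by
  rw [← D.out_edge]
  exact congrArg D.out (a.inner _ h).symm

/-- The sign of a kink does not depend on the orientation, since both strands of the crossing are
reversed together. -/
theorem writhe_kink {i : ZMod 4} (a : Placement D.toSurfaceDiagram arc X M)
    (b : Placement D'.toSurfaceDiagram (kink i) X M)
    (hout : ∀ u, D.out (a.port u) = D'.out (b.port u)) :
    D'.writhe = D.writhe + if i = 0 ∨ i = 2 then -1 else 1 := by
  have h := a.writhe_sub_eq b hout
  have hP : ∑ y : arc.Crossing, D.sign (a.crossing (.inr y)) = 0 := rfl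
  have hP' : ∑ y : (kink i).Crossing, D'.sign (b.crossing (.inr y)) =
    D'.sign (b.crossing (.inr ())) + 0 := rfl
  let g (k : ZMod 4) : Bool := D'.out (b.inside (.inl ((), k)))
  have hg (k) : g (k + 2) = !g k := b.out_inside_add_two () k
  have hi : g (i + 1) = !g i := b.out_inner (.head _)
  have hsign : D'.sign (b.crossing (.inr ())) = if g 0 = g 1 then 1 else -1 := rfl
  have h0 : g 2 = !g 0 := hg 0
  have h1 : g 3 = !g 1 := hg 1
  rw [hP, hP', sub_zero, add_zero, hsign] at h
  have four : ∀ i : ZMod 4, i = 0 ∨ i = 1 ∨ i = 2 ∨ i = 3 := by decide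
  rw [← sub_eq_iff_eq_add', h]
  rcases four i with rfl | rfl | rfl | rfl
  · replace hi : g 1 = !g 0 := hi
    simp [hi]
  · replace hi : g 2 = !g 1 := hi
    rw [if_pos (by rw [h0, Bool.not_inj_iff] at hi; exact hi), if_neg (by decide)]
  · replace hi : g 3 = !g 2 := hi
    rw [if_neg (by rw [h1, h0, Bool.not_inj_iff] at hi; simp [hi]), if_pos (by decide)]
  · replace hi : g 0 = !g 3 := hi
    rw [if_pos (by rw [h1, Bool.not_not] at hi; exact hi), if_neg (by decide)]

theorem writhe_bigon (a : Placement D.toSurfaceDiagram twoArcs X M)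
    (b : Placement D'.toSurfaceDiagram bigon X M)
    (hout : ∀ u, D.out (a.port u) = D'.out (b.port u)) : D'.writhe = D.writhe := by
  have h := a.writhe_sub_eq b hout
  have hP : ∑ y : twoArcs.Crossing, D.sign (a.crossing (.inr y)) = 0 := rfl
  have hP' : ∑ y : bigon.Crossing, D'.sign (b.crossing (.inr y)) =
    D'.sign (b.crossing (.inr true)) + D'.sign (b.crossing (.inr false)) := Fintype.sum_bool _
  let g (x : Bool) (k : ZMod 4) : Bool := D'.out (b.inside (.inl (x, k)))
  have hg (x k) : g x (k + 2) = !g x k := b.out_inside_add_two x k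
  have hsign (x : Bool) : D'.sign (b.crossing (.inr x)) = if g x 0 = g x 1 then 1 else -1 := rfl
  have h0 : g true 2 = !g false 2 := b.out_inner (.head _)
  have h1 : g true 1 = !g false 3 := b.out_inner (.tail _ (.head _))
  have e0 : g true 2 = !g true 0 := hg true 0
  have e1 : g false 2 = !g false 0 := hg false 0
  have e2 : g false 3 = !g false 1 := hg false 1
  rw [e0, e1, Bool.not_inj_iff] at h0
  rw [e2, Bool.not_not] at h1
  rw [hP, hP', sub_zero, hsign, hsign, h0, h1] at h
  have : (if (!g false 0) = g false 1 then (1 : ℤ) else -1) +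
      (if g false 0 = g false 1 then 1 else -1) = 0 := by
    cases g false 0 <;> cases g false 1 <;> rfl
  rw [this] at h
  exact sub_eq_zero.1 h

/-- Each of the three crossings keeps its sign, since the directions of the three strands can be
read off at the ends. -/
theorem writhe_triangle {s : ℤˣ} (a : Placement D.toSurfaceDiagram (triangle s) X M)
    (b : Placement D'.toSurfaceDiagram (triangleMoved s) X M)
    (hout : ∀ u, D.out (a.port u) = D'.out (b.port u)) : D'.writhe = D.writhe := by
  have h := a.writhe_sub_eq b hout
  let g (x : Triple) (k : ZMod 4) : Bool := D.out (a.inside (.inl (x, (s : ℤ) * k)))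
  let g' (x : Triple) (k : ZMod 4) : Bool := D'.out (b.inside (.inl (x, (s : ℤ) * k)))
  have hs : ((s : ℤ) : ZMod 4) * 2 = 2 := by rcases Int.units_eq_one_or s with rfl | rfl <;> rfl
  have hg (x k) : g x (k + 2) = !g x k := by
    simp only [g, mul_add, hs]; exact a.out_inside_add_two x _
  have hg' (x k) : g' x (k + 2) = !g' x k := by
    simp only [g', mul_add, hs]; exact b.out_inside_add_two x _
  have a0 (x) : g x 2 = !g x 0 := hg x 0
  have a1 (x) : g x 3 = !g x 1 := hg x 1
  have b0 (x) : g' x 2 = !g' x 0 := hg' x 0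
  have b1 (x) : g' x 3 = !g' x 1 := hg' x 1
  have p0 : g .topMiddle 2 = g' .topBottom 2 := hout (.inr 0)
  have p1 : g .topMiddle 3 = g' .middleBottom 2 := hout (.inr 1)
  have p2 : g .topBottom 3 = g' .middleBottom 3 := hout (.inr 2)
  have p3 : g .topBottom 0 = g' .topMiddle 0 := hout (.inr 3)
  have p4 : g .middleBottom 0 = g' .topMiddle 1 := hout (.inr 4)
  have p5 : g .middleBottom 1 = g' .topBottom 1 := hout (.inr 5)
  have i0 : g' .topMiddle 2 = !g' .topBottom 0 := b.out_inner (.head _)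
  have i1 : g' .middleBottom 0 = !g' .topMiddle 3 := b.out_inner (.tail _ (.head _))
  have i2 : g' .middleBottom 1 = !g' .topBottom 3 := b.out_inner (.tail _ (.tail _ (.head _)))
  simp only [a0, a1, b0, b1, Bool.not_inj_iff, Bool.not_not] at p0 p1 p2 i0 i1 i2
  have key (x) : g x 0 = g' x 0 ∧ g x 1 = g' x 1 := by
    cases x
    · exact ⟨p0.trans i0.symm, p1.trans i1⟩
    · exact ⟨p3.trans i0, p2.trans i2⟩
    · exact ⟨p4.trans i1.symm, p5.trans i2.symm⟩
  -- the sign compares the darts `0` and `1`, but in the reflected picture `key` is about `0` and `-1`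
  have hsign (x : Triple) : D'.sign (b.crossing (.inr x)) = D.sign (a.crossing (.inr x)) := by
    obtain ⟨k0, k1⟩ := key x
    have e : D.out (a.inside (.inl (x, 0))) = D'.out (b.inside (.inl (x, 0))) := by
      simpa only [g, g', mul_zero] using k0
    have e' : D.out (a.inside (.inl (x, 1))) = D'.out (b.inside (.inl (x, 1))) := by
      simp only [g, g', mul_one] at k1
      rcases Int.units_eq_one_or s with rfl | rfl
      · exact k1
      · have h1 := a.out_inside_add_two x 1
        have h2 := b.out_inside_add_two x 1
        replace h1 : D.out (a.inside (.inl (x, ((-1 : ℤˣ) : ℤ)))) = _ := h1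
        replace h2 : D'.out (b.inside (.inl (x, ((-1 : ℤˣ) : ℤ)))) = _ := h2
        rw [h1, h2, Bool.not_inj_iff] at k1
        exact k1
    change (if D'.out (b.inside (.inl (x, 0))) = D'.out (b.inside (.inl (x, 1))) then (1 : ℤ) else -1) =
      if D.out (a.inside (.inl (x, 0))) = D.out (a.inside (.inl (x, 1))) then 1 else -1
    rw [e, e']
  have : ∑ y : (triangleMoved s).Crossing, D'.sign (b.crossing (.inr y)) =
      ∑ y : (triangle s).Crossing, D.sign (a.crossing (.inr y)) :=
    Finset.sum_congr rfl fun x _ => hsign x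
  rw [this, sub_self] at h
  exact sub_eq_zero.1 h

end Placement

/-! ### Smoothing a crossing of a planar diagram -/

namespace Placement

variable {D : SurfaceDiagram} {n : ℕ} {X M : Type}

/-- The darts outside of a local picture and its ends, as darts of a diagram that is composed of the
outside and a picture all of whose darts are ends. -/
noncomputable def fillEquiv (P : LocalPicture n) (hP : P.ends.Bijective) :
    Dart X M ⊕ Fin n ≃ Dart (X ⊕ P.Crossing) (M ⊕ P.Mark) :=
  Equiv.ofBijective (Sum.elim (Dart.map Sum.inl Sum.inl) fun i => (P.ends i).map Sum.inr Sum.inr) (by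
    constructor
    · have h (d d' : Dart P.Crossing P.Mark) (hd : d.map (X' := X ⊕ P.Crossing) (M' := M ⊕ P.Mark)
          Sum.inr Sum.inr = d'.map Sum.inr Sum.inr) : d = d' := by
        rcases d with ⟨x, i⟩ | ⟨m, j⟩ <;> rcases d' with ⟨x', i'⟩ | ⟨m', j'⟩ <;>
          simp_all [Dart.map]
      rintro (d | i) (d' | i') hd
      · rcases d with ⟨x, i⟩ | ⟨m, j⟩ <;> rcases d' with ⟨x', i'⟩ | ⟨m', j'⟩ <;>
          simp_all [Dart.map]
      · rcases d with d | d <;> rcases hi : P.ends i' with d' | d' <;> simp [hi, Dart.map] at hd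
      · rcases d' with d' | d' <;> rcases hi : P.ends i with d | d <;> simp [hi, Dart.map] at hd
      · rw [hP.1 (h _ _ hd)]
    · rintro (⟨x | x, i⟩ | ⟨m | m, j⟩)
      · exact ⟨.inl (.inl (x, i)), rfl⟩
      · obtain ⟨k, hk⟩ := hP.2 (.inl (x, i))
        exact ⟨.inr k, by simp [hk, Dart.map]⟩
      · exact ⟨.inl (.inr (m, j)), rfl⟩
      · obtain ⟨k, hk⟩ := hP.2 (.inr (m, j))
        exact ⟨.inr k, by simp [hk, Dart.map]⟩)

/-- The diagram that arises when a local picture is replaced by one that has no inner edges. -/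
noncomputable def fill {Q : LocalPicture n} [Q.Effective] (a : Placement D Q X M) (hQ : Q.IsTidy)
    (P : LocalPicture n) [P.Effective] (hP : P.ends.Bijective) : SurfaceDiagram where
  Crossing := X ⊕ P.Crossing
  Mark := M ⊕ P.Mark
  finite_crossing := have := a.finite_outside.1; inferInstance
  finite_mark := have := a.finite_outside.2; inferInstance
  edge d := fillEquiv P hP (a.portEdge hQ ((fillEquiv P hP).symm d))
  edge_edge d := by simp [a.portEdge_portEdge]
  edge_ne d h := by
    have h1 := congrArg a.port ((Equiv.eq_symm_apply _).2 h)
    rw [← a.edge_port] at h1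
    exact D.edge_ne _ h1

variable {Q : LocalPicture n} [Q.Effective] (a : Placement D Q X M) (hQ : Q.IsTidy)
    (P : LocalPicture n) [P.Effective] (hP : P.ends.Bijective)

/-- The new picture in the diagram `fill`. -/
def fillPlacement (hinner : P.inner = []) : Placement (a.fill hQ P hP) P X M where
  crossing := Equiv.refl _
  mark := Equiv.refl _
  inner := by simp [hinner]

theorem sameOutside_fillPlacement (hinner : P.inner = []) :
    a.SameOutside (a.fillPlacement hQ P hP hinner) := by
  intro u v
  have h (u) : (a.fillPlacement hQ P hP hinner).port u = fillEquiv P hP u := by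
    rcases u with d | i <;> rfl
  have hedge : (a.fill hQ P hP).edge ((a.fillPlacement hQ P hP hinner).port u) =
      fillEquiv P hP (a.portEdge hQ u) :=
    congrArg (fun w => fillEquiv P hP (a.portEdge hQ w))
      ((congrArg (fillEquiv P hP).symm (h u)).trans ((fillEquiv P hP).symm_apply_apply u))
  refine Iff.trans ?_ ((fillEquiv P hP).apply_eq_iff_eq.symm.trans
    (Iff.of_eq (congrArg₂ Eq hedge (h v)).symm))
  rw [a.edge_port hQ, (a.port_injective hQ).eq_iff]

/-- A smoothing of a crossing of a planar diagram is planar. The darts at the crossing are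
regrouped to the pairs `p + 1, p + 2` and `p + 3, p`. -/
theorem isPlanar_fill (a : Placement D LocalPicture.crossing X M) (hD : D.IsPlanar)
    (P : LocalPicture 4) [P.Effective] (hP : P.ends.Bijective) (p : Fin 4) (π : Fin 4 → Fin 4)
    (hπ : ∀ i, (P.ends i).rot = P.ends (π i))
    (hp : π (p + 1) = p + 2 ∧ π (p + 2) = p + 1 ∧ π (p + 3) = p ∧ π p = p + 3) :
    (a.fill LocalPicture.isRegular_crossing.1 P hP).IsPlanar := by
  classical
  have hQ := LocalPicture.isRegular_crossing.1
  have := a.finite_outside.1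
  have := a.finite_outside.2
  have := Fintype.ofFinite (Dart X M)
  have := Fintype.ofFinite (Dart D.Crossing D.Mark)
  have := Fintype.ofFinite (Dart (a.fill hQ P hP).Crossing (a.fill hQ P hP).Mark)
  have hends : LocalPicture.crossing.ends.Bijective :=
    ⟨by decide +kernel, fun d => hQ.2.2.1 d rfl⟩
  have hport : a.port.Bijective := by
    refine ⟨a.port_injective hQ, fun d => ?_⟩
    obtain ⟨d | d, rfl⟩ := a.dart_bijective.2 d
    · exact ⟨.inl d, rfl⟩
    · obtain ⟨i, rfl⟩ := hends.2 d
      exact ⟨.inr i, rfl⟩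
  let e := Equiv.ofBijective _ hport
  let r : Dart X M ⊕ Fin 4 → Dart X M ⊕ Fin 4 := Sum.map Dart.rot (· + 1)
  let r' : Dart X M ⊕ Fin 4 → Dart X M ⊕ Fin 4 := Sum.map Dart.rot π
  have hr (u) : a.port (r u) = (a.port u).rot := by
    rcases u with (d | d) | i
    · rfl
    · rfl
    · fin_cases i <;> rfl
  have h1 : IsAcyclic (a.portEdge hQ) r := by
    refine (D.isPlanar_iff_isAcyclic.1 hD).congr e.symm ?_ ?_ <;> intro d <;>
      obtain ⟨u, rfl⟩ := e.surjective d <;> rw [Equiv.symm_apply_apply, Equiv.symm_apply_eq]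
    · exact a.edge_port hQ u
    · exact (hr u).symm
  have h2 : IsAcyclic (a.portEdge hQ) r' := by
    have h4 : ∀ p : Fin 4, p + 1 + 1 = p + 2 ∧ p + 2 + 1 = p + 3 ∧ p + 3 + 1 = p := by decide
    have r1 (k : Fin 4) : r (.inr k) = .inr (k + 1) := rfl
    have r2 (k : Fin 4) : r' (.inr k) = .inr (π k) := rfl
    have hcases : ∀ p k : Fin 4, k = p ∨ k = p + 1 ∨ k = p + 2 ∨ k = p + 3 := by decide
    refine h1.split (a.portEdge_portEdge hQ) (.inr p) ?_ ?_ ?_ ?_ ?_ ?_ ?_ ?_ ?_ <;>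
      simp only [r1, h4]
    · simp
    · simp
    · rw [r2, hp.1]
    · rw [r2, hp.2.1]
    · rw [r2, hp.2.2.1]
    · rw [r2, hp.2.2.2]
    · rintro (d | k)
      · simp [r']
      · rw [r2]
        simp only [Sum.inr.injEq]
        rcases hcases p k with rfl | rfl | rfl | rfl
        · rw [hp.2.2.2]; clear hp; revert k; decide
        · rw [hp.1]; clear hp; revert p; decide
        · rw [hp.2.1]; clear hp; revert p; decide
        · rw [hp.2.2.1]; clear hp; revert p; decide
    · rintro (d | k) e0 e1 e2 e3
      · rfl
      · simp only [ne_eq, Sum.inr.injEq] at e0 e1 e2 e3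
        rcases hcases p k with h | h | h | h <;> contradiction
  rw [SurfaceDiagram.isPlanar_iff_isAcyclic]
  refine h2.congr (fillEquiv P hP) (fun u => ?_) fun u => ?_
  · exact (congrArg (fun u => fillEquiv P hP (a.portEdge hQ u))
      ((fillEquiv P hP).symm_apply_apply u)).symm
  · rcases u with (d | d) | i
    · rfl
    · rfl
    · change (P.ends (π i)).map _ _ = ((P.ends i).map _ _).rot
      rw [← hπ]
      rcases P.ends i with d | d <;> rfl

end Placement

namespace LinkDiagram

/-- The local picture of a crossing. -/
noncomputable def crossingPlacement (D : SurfaceDiagram) (x : D.Crossing) :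
    Placement D LocalPicture.crossing {y // y ≠ x} D.Mark where
  crossing := haveI := Classical.decEq D.Crossing
    (Equiv.optionEquivSumPUnit {y // y ≠ x}).symm.trans (Equiv.optionSubtypeNe x)
  mark := Equiv.sumEmpty D.Mark Empty
  inner := fun _ h => nomatch h

/-- Every crossing can be smoothed in both ways, and this lowers the number of crossings. -/
theorem exists_smoothings (H : LinkDiagram) (x : H.Crossing) :
    ∃ (I II : LinkDiagram) (X M : Type) (A : Placement H.toSurfaceDiagram LocalPicture.crossing X M)
      (B : Placement I.toSurfaceDiagram LocalPicture.smoothI X M)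
      (C : Placement II.toSurfaceDiagram LocalPicture.smoothII X M),
      A.SameOutside B ∧ A.SameOutside C ∧ I.crossingNumber < H.crossingNumber ∧
        II.crossingNumber < H.crossingNumber := by
  let A := crossingPlacement H.toSurfaceDiagram x
  have hQ := LocalPicture.isRegular_crossing.1
  have hI : LocalPicture.smoothI.ends.Bijective :=
    ⟨by decide +kernel, fun d => LocalPicture.isRegular_smoothI.1.2.2.1 d rfl⟩
  have hII : LocalPicture.smoothII.ends.Bijective :=
    ⟨by decide +kernel, fun d => LocalPicture.isRegular_smoothII.1.2.2.1 d rfl⟩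
  refine ⟨⟨A.fill hQ LocalPicture.smoothI hI, A.isPlanar_fill H.planar _ hI 0 ![3, 2, 1, 0]
      (by decide +kernel) (by decide), ⟨Placement.fillEquiv _ hI (.inr 0)⟩⟩,
    ⟨A.fill hQ LocalPicture.smoothII hII, A.isPlanar_fill H.planar _ hII 1 ![1, 0, 3, 2]
      (by decide +kernel) (by decide), ⟨Placement.fillEquiv _ hII (.inr 0)⟩⟩, _, _, A,
    A.fillPlacement hQ _ hI rfl, A.fillPlacement hQ _ hII rfl,
    A.sameOutside_fillPlacement hQ _ hI rfl, A.sameOutside_fillPlacement hQ _ hII rfl, ?_, ?_⟩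
  · rw [A.crossingNumber_eq, (A.fillPlacement hQ _ hI rfl).crossingNumber_eq]
    have h1 : Nat.card LocalPicture.smoothI.Crossing = 0 := Nat.card_of_isEmpty (α := Empty)
    have h2 : Nat.card LocalPicture.crossing.Crossing = 1 := Nat.card_unique (α := Unit)
    omega
  · rw [A.crossingNumber_eq, (A.fillPlacement hQ _ hII rfl).crossingNumber_eq]
    have h1 : Nat.card LocalPicture.smoothII.Crossing = 0 := Nat.card_of_isEmpty (α := Empty)
    have h2 : Nat.card LocalPicture.crossing.Crossing = 1 := Nat.card_unique (α := Unit)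
    omega

end LinkDiagram

/-! ### Consequences of the relations in the coefficient ring -/

namespace SkeinRing

open SkeinGen

theorem mkRingHom_poly (x : SkeinGen) : RingQuot.mkRingHom SkeinGen.Rel (poly x) = gen x := rfl

theorem gen_g_mul_gen_h (w : ℤ) (c μ : ℕ) : gen (g w c μ) * gen (h w c μ) = 1 := by
  simpa only [map_mul, map_one, mkRingHom_poly] using RingQuot.mkRingHom_rel (Rel.g_mul_h w c μ)

theorem gen_a'_mul_gen_b : gen a' * gen b = gen a * gen b := by
  simpa only [map_mul, mkRingHom_poly] using RingQuot.mkRingHom_rel Rel.a'_b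

theorem gen_a_mul_gen_b' : gen a * gen b' = gen a * gen b := by
  simpa only [map_mul, mkRingHom_poly] using RingQuot.mkRingHom_rel Rel.a_b'

theorem gen_a_mul_gen_a' : gen a * gen a = gen a * gen a' := by
  simpa only [map_mul, mkRingHom_poly] using RingQuot.mkRingHom_rel Rel.a_a'

theorem gen_b_mul_gen_b' : gen b * gen b = gen b * gen b' := by
  simpa only [map_mul, mkRingHom_poly] using RingQuot.mkRingHom_rel Rel.b_b'

theorem reidemeisterI_pos (w : ℤ) (c μ : ℕ) (n : ℕ+) :
    gen (g (w + 1) (c + 1) μ) * (gen a * gen (v (n + 1)) + gen b * gen (v n)) =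
      gen (g w c μ) * gen (v n) := by
  simpa only [map_mul, map_add, mkRingHom_poly] using
    RingQuot.mkRingHom_rel (Rel.reidemeisterI_pos w c μ n)

theorem reidemeisterI_neg (w : ℤ) (c μ : ℕ) (n : ℕ+) :
    gen (g (w - 1) (c + 1) μ) * (gen b * gen (v (n + 1)) + gen a * gen (v n)) =
      gen (g w c μ) * gen (v n) := by
  simpa only [map_mul, map_add, mkRingHom_poly] using
    RingQuot.mkRingHom_rel (Rel.reidemeisterI_neg w c μ n)

/-- The values `v n` do not distinguish `a` from `a'`: by the first Reidemeister I relation, `v n`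
is a multiple of a combination of `a` and `b`, and these are not changed by `a - a'`. -/
theorem gen_a'_mul_gen_v (n : ℕ+) : gen a' * gen (v n) = gen a * gen (v n) := by
  have h1 := gen_g_mul_gen_h 0 0 0
  have h2 := reidemeisterI_pos 0 0 0 n
  have h3 := gen_a_mul_gen_a'
  have h4 := gen_a'_mul_gen_b
  linear_combination (-(gen a' - gen a) * gen (v n)) * h1 -
    (gen a' - gen a) * gen (h 0 0 0) * h2 -
    gen (h 0 0 0) * gen (g (0 + 1) (0 + 1) 0) * gen (v (n + 1)) * h3 +
    gen (h 0 0 0) * gen (g (0 + 1) (0 + 1) 0) * gen (v n) * h4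

theorem gen_b'_mul_gen_v (n : ℕ+) : gen b' * gen (v n) = gen b * gen (v n) := by
  have h1 := gen_g_mul_gen_h 0 0 0
  have h2 := reidemeisterI_pos 0 0 0 n
  have h3 := gen_a_mul_gen_b'
  have h4 := gen_b_mul_gen_b'
  linear_combination (-(gen b' - gen b) * gen (v n)) * h1 -
    (gen b' - gen b) * gen (h 0 0 0) * h2 +
    gen (h 0 0 0) * gen (g (0 + 1) (0 + 1) 0) * gen (v (n + 1)) * h3 -
    gen (h 0 0 0) * gen (g (0 + 1) (0 + 1) 0) * gen (v n) * h4

/-- The Reidemeister II relation without primed generators. It belongs to the states in which the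
saddle move lowers the number of closed curves. -/
theorem reidemeisterII (w : ℤ) (c μ : ℕ) (n : ℕ+) :
    gen (g w (c + 2) μ) * (gen a * gen b * gen (v (n + 1)) +
        (gen a * gen a + gen b * gen b) * gen (v n) + gen a * gen b * gen (v (n + 1))) =
      gen (g w c μ) * gen (v (n + 1)) := by
  have h := RingQuot.mkRingHom_rel (Rel.reidemeisterII w c μ n)
  simp only [map_mul, map_add, mkRingHom_poly] at h
  have h1 := gen_a'_mul_gen_v n
  have h2 := gen_a'_mul_gen_v (n + 1)
  have h3 := gen_b'_mul_gen_v n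
  have h4 := gen_b'_mul_gen_v (n + 1)
  linear_combination h - gen (g w (c + 2) μ) * (gen a * h1 + gen b * h2 + gen b' * h2 + gen a * h4 +
    (gen b' + gen b) * h3)

/-- The counterpart of the Reidemeister II relation for a state in which the saddle move raises the
number of closed curves. It expresses the composition of two Reidemeister I moves of opposite signs.
-/
theorem reidemeisterII_of_reidemeisterI (w : ℤ) (c μ : ℕ) (n : ℕ+) :
    gen (g w (c + 2) μ) * (gen a * gen b * gen (v n) +
        (gen a * gen a + gen b * gen b) * gen (v (n + 1)) + gen a * gen b * gen (v (n + 1 + 1))) =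
      gen (g w c μ) * gen (v n) := by
  have h1 := reidemeisterI_pos w c μ n
  have h2 := reidemeisterI_neg (w + 1) (c + 1) μ n
  have h3 := reidemeisterI_neg (w + 1) (c + 1) μ (n + 1)
  rw [add_sub_cancel_right] at h2 h3
  linear_combination h1 + gen b * h2 + gen a * h3

/-- The value of `k` closed curves; the value for `k = 0` is irrelevant. -/
noncomputable def loopValue (k : ℕ) : SkeinRing := gen (v k.toPNat')

theorem loopValue_coe (n : ℕ+) : loopValue n = gen (v n) := by rw [loopValue, PNat.coe_toPNat']

theorem toPNat'_add_one {n : ℕ} (hn : 0 < n) : (n + 1).toPNat' = n.toPNat' + 1 := by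
  lift n to ℕ+ using hn
  rw [PNat.coe_toPNat', ← PNat.one_coe, ← PNat.add_coe, PNat.coe_toPNat']

/-- The effect of a positive kink on the value of `n` closed curves. -/
theorem a_mul_loopValue_add (w : ℤ) (c μ : ℕ) {n : ℕ} (hn : 0 < n) :
    gen a * loopValue (n + 1) + gen b * loopValue n =
      gen (h (w + 1) (c + 1) μ) * gen (g w c μ) * loopValue n := by
  unfold loopValue
  rw [toPNat'_add_one hn]
  linear_combination gen (h (w + 1) (c + 1) μ) * reidemeisterI_pos w c μ n.toPNat' -
    (gen a * gen (v (n.toPNat' + 1)) + gen b * gen (v n.toPNat')) *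
      gen_g_mul_gen_h (w + 1) (c + 1) μ

/-- The effect of a negative kink on the value of `n` closed curves. -/
theorem b_mul_loopValue_add (w : ℤ) (c μ : ℕ) {n : ℕ} (hn : 0 < n) :
    gen b * loopValue (n + 1) + gen a * loopValue n =
      gen (h (w - 1) (c + 1) μ) * gen (g w c μ) * loopValue n := by
  unfold loopValue
  rw [toPNat'_add_one hn]
  linear_combination gen (h (w - 1) (c + 1) μ) * reidemeisterI_neg w c μ n.toPNat' -
    (gen b * gen (v (n.toPNat' + 1)) + gen a * gen (v n.toPNat')) *
      gen_g_mul_gen_h (w - 1) (c + 1) μ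

/-- The effect of a Reidemeister II move on a state; `n` is the number of closed curves before the
move, and `m` the number after a saddle move, of which planarity allows only these two values. -/
theorem loopValue_bigon (w : ℤ) (c μ : ℕ) (n : ℕ) (hn : n > 0) (m : ℕ) (hm : m > 0)
    (hnm : n = m + 1 ∨ m = n + 1) :
    gen a * gen b * loopValue n + (gen a * gen a + gen b * gen b) * loopValue m +
        gen a * gen b * loopValue (m + 1) =
      gen (h w (c + 2) μ) * gen (g w c μ) * loopValue n := by
  have h1 := gen_g_mul_gen_h w (c + 2) μ
  unfold loopValue
  rcases hnm with rfl | rfl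
  · rw [toPNat'_add_one hm]
    linear_combination gen (h w (c + 2) μ) * reidemeisterII w c μ m.toPNat' -
      (gen a * gen b * gen (v (m.toPNat' + 1)) + (gen a * gen a + gen b * gen b) * gen (v m.toPNat') +
        gen a * gen b * gen (v (m.toPNat' + 1))) * h1
  · rw [toPNat'_add_one hm, toPNat'_add_one hn]
    linear_combination gen (h w (c + 2) μ) * reidemeisterII_of_reidemeisterI w c μ n.toPNat' -
      (gen a * gen b * gen (v n.toPNat') +
        (gen a * gen a + gen b * gen b) * gen (v (n.toPNat' + 1)) +
        gen a * gen b * gen (v (n.toPNat' + 1 + 1))) * h1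

end SkeinRing

/-! ### The invariant -/

open SkeinGen SkeinRing

/-- The state sum with values in the coefficient ring. -/
noncomputable def skeinBracket (D : LinkDiagram) : SkeinRing :=
  D.bracket (gen a) (gen b) loopValue

theorem mul_bracket_eq {x y A B : SkeinRing} (hxy : ∀ n, x * loopValue n = y * loopValue n)
    (D : SurfaceDiagram) : x * D.bracket A B loopValue = y * D.bracket A B loopValue := by
  simp only [SurfaceDiagram.bracket, mul_stateSum, hxy]

theorem isDiagramInvariant_skeinBracket : IsDiagramInvariant skeinBracket := by
  rintro D D' (⟨⟨φ⟩⟩ | ⟨⟨S⟩⟩)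
  · exact φ.bracket_eq _ _ _
  · exact S.bracket_eq _ _ _

/-- The state sum satisfies the relation with `a` and `b` at every crossing. At crossings of
different components it satisfies the other one as well, as its values are combinations of the
`v n`. -/
theorem satisfiesSkeinRelations_skeinBracket : SatisfiesSkeinRelations skeinBracket := by
  intro H I II X M A B C hAB hAC
  have h : skeinBracket H = gen a * skeinBracket I + gen b * skeinBracket II :=
    Placement.bracket_crossing hAB hAC
  refine ⟨fun _ => h, fun _ => ?_⟩
  rw [h]
  unfold skeinBracket
  rw [mul_bracket_eq fun n => gen_a'_mul_gen_v n.toPNat',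
    mul_bracket_eq fun n => gen_b'_mul_gen_v n.toPNat']

theorem takesTrivialValues_skeinBracket : TakesTrivialValues skeinBracket := by
  intro D n hc hn
  have : IsEmpty D.Crossing := (Nat.card_eq_zero.1 hc).resolve_right fun h => h.not_finite inferInstance
  unfold skeinBracket SurfaceDiagram.bracket
  rw [stateSum_of_isEmpty, ← loopValue_coe, ← hn]
  congr 2
  ext1 d
  rcases d with ⟨x, _⟩ | _
  · exact isEmptyElim x
  · rfl

/-- Uniqueness, by induction on the number of crossings. -/
theorem SatisfiesSkeinRelations.eq_of_takesTrivialValues {f f' : LinkDiagram → SkeinRing}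
    (hf : SatisfiesSkeinRelations f) (hf' : SatisfiesSkeinRelations f') (hv : TakesTrivialValues f)
    (hv' : TakesTrivialValues f') : f = f' := by
  ext1 D
  induction hc : D.crossingNumber using Nat.strong_induction_on generalizing D with
  | _ c ih =>
  rcases isEmpty_or_nonempty D.Crossing with h | ⟨⟨x⟩⟩
  · have hc0 : D.crossingNumber = 0 := Nat.card_of_isEmpty
    have := D.nonempty
    have hpos : 0 < D.componentNumber := loopCount_pos D.edge Dart.opp
    rw [hv D ⟨_, hpos⟩ hc0 rfl, hv' D ⟨_, hpos⟩ hc0 rfl]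
  · obtain ⟨I, II, X, M, A, B, C, hAB, hAC, hI, hII⟩ := D.exists_smoothings x
    have eI := ih _ (hc ▸ hI) I rfl
    have eII := ih _ (hc ▸ hII) II rfl
    have h1 := hf D I II X M A B C hAB hAC
    have h2 := hf' D I II X M A B C hAB hAC
    by_cases h : D.component (A.port (.inr 0)) = D.component (A.port (.inr 1))
    · rw [h1.1 h, h2.1 h, eI, eII]
    · rw [h1.2 h, h2.2 h, eI, eII]

namespace Placement

open LocalPicture

theorem componentNumber_eq_of_sameOutside {D D' : SurfaceDiagram} {n : ℕ} {P P' : LocalPicture n}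
    {X M : Type} [P.Effective] [P'.Effective] {A : Placement D P X M} {B : Placement D' P' X M}
    (hAB : A.SameOutside B) (hP : P.IsRegular) (hP' : P'.IsRegular)
    (h : P.matching Dart.opp = P'.matching Dart.opp ∧ P.closedCount Dart.opp = P'.closedCount Dart.opp) :
    D.componentNumber = D'.componentNumber := by
  rw [A.componentNumber_eq hP, B.componentNumber_eq hP', hAB.portEdge_eq hP.1 hP'.1, h.1, h.2]

end Placement

theorem isLinkInvariant_normalised_skeinBracket : IsLinkInvariant (normalised skeinBracket) := by
  intro D D' hmove
  unfold normalised
  cases hmove with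
  | iso φ hout =>
    rw [φ.crossingNumber_eq, φ.componentNumber_eq, φ.writhe_eq hout,
      isDiagramInvariant_skeinBracket _ _ (.inl ⟨φ⟩)]
  | subdivision S hout =>
    rw [S.crossingNumber_eq, S.componentNumber_eq, S.writhe_eq hout,
      isDiagramInvariant_skeinBracket _ _ (.inr ⟨S⟩)]
  | reidemeister P P' hmove X M A B hsame hout =>
    cases hmove with
    | one i =>
      have hμ : D.componentNumber = D'.componentNumber :=
        Placement.componentNumber_eq_of_sameOutside hsame LocalPicture.isRegular_arc
          (LocalPicture.isRegular_kink i) (by clear hsame hout B; revert i; decide +kernel)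
      have hc : D'.crossingNumber = D.crossingNumber + 1 := by
        rw [A.crossingNumber_eq, B.crossingNumber_eq]
        have h1 : Nat.card LocalPicture.arc.Crossing = 0 := Nat.card_of_isEmpty (α := Empty)
        have h2 : Nat.card (LocalPicture.kink i).Crossing = 1 := Nat.card_unique (α := Unit)
        omega
      rw [← hμ, hc, A.writhe_kink B hout]
      split_ifs with hi
      · rw [show skeinBracket D'.toLinkDiagram = _ from Placement.bracket_kink_of_even hsame hi
          fun n hn => b_mul_loopValue_add D.writhe D.crossingNumber D.componentNumber hn]
        rw [← sub_eq_add_neg, ← mul_assoc, ← mul_assoc, gen_g_mul_gen_h, one_mul]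
        rfl
      · have hi' : i = 1 ∨ i = 3 := by clear hsame hout B; revert i; decide
        rw [show skeinBracket D'.toLinkDiagram = _ from Placement.bracket_kink_of_odd hsame hi'
          fun n hn => a_mul_loopValue_add D.writhe D.crossingNumber D.componentNumber hn]
        rw [← mul_assoc, ← mul_assoc, gen_g_mul_gen_h, one_mul]
        rfl
    | two =>
      have hμ : D.componentNumber = D'.componentNumber :=
        Placement.componentNumber_eq_of_sameOutside hsame LocalPicture.isRegular_twoArcs
          LocalPicture.isRegular_bigon (by decide +kernel)
      have hc : D'.crossingNumber = D.crossingNumber + 2 := by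
        rw [A.crossingNumber_eq, B.crossingNumber_eq]
        have h1 : Nat.card LocalPicture.twoArcs.Crossing = 0 := Nat.card_of_isEmpty (α := Empty)
        have h2 : Nat.card LocalPicture.bigon.Crossing = 2 := Nat.card_eq_fintype_card (α := Bool)
        omega
      rw [← hμ, hc, A.writhe_bigon B hout]
      rw [show skeinBracket D'.toLinkDiagram = _ from Placement.bracket_bigon hsame D'.planar
        (loopValue_bigon D.writhe D.crossingNumber D.componentNumber)]
      rw [← mul_assoc, ← mul_assoc, gen_g_mul_gen_h, one_mul]
      rfl
    | three s =>
      have hμ : D.componentNumber = D'.componentNumber :=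
        Placement.componentNumber_eq_of_sameOutside hsame (LocalPicture.isRegular_triangle s)
          (LocalPicture.isRegular_triangleMoved s)
          (by rcases Int.units_eq_one_or s with rfl | rfl <;> decide +kernel)
      have hc : D'.crossingNumber = D.crossingNumber := by
        rw [A.crossingNumber_eq, B.crossingNumber_eq]
        rfl
      rw [← hμ, hc, A.writhe_triangle B hout]
      congr 1
      -- any writhe, crossing number and number of components will do here, as `ρ` cancels
      exact Placement.bracket_triangle hsame D.planar (loopValue_bigon 0 0 0)

/-! ### The Jones polynomial -/

open LaurentPolynomial

/-- The image `(-t ^ (3 / 4)) ^ w` of `g w c μ`, where `T 1` stands for `t ^ (1 / 4)`. -/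
noncomputable def jonesFactor (w : ℤ) : LaurentPolynomial ℤ := ((w.negOnePow : ℤˣ) : ℤ) • T (3 * w)

/-- The values of the generators that lead to the Jones polynomial. -/
noncomputable def jonesValue : SkeinGen → LaurentPolynomial ℤ
  | .e | .e' => 0
  | .a | .a' => T (-1)
  | .b | .b' => T 1
  | .v n => (- T 2 - T (-2)) ^ n.natPred
  | .g w _ _ => jonesFactor w
  | .h w _ _ => jonesFactor (-w)

theorem T_one_mul_T_neg_one : (T 1 * T (-1) : LaurentPolynomial ℤ) = 1 := by
  rw [← T_add]; simp

theorem jonesFactor_zero : jonesFactor 0 = 1 := by simp [jonesFactor]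

theorem jonesFactor_add (w w' : ℤ) : jonesFactor (w + w') = jonesFactor w * jonesFactor w' := by
  unfold jonesFactor
  rw [smul_mul_smul_comm, ← T_add, Int.negOnePow_add, mul_add, Units.val_mul]

theorem jonesFactor_one : jonesFactor 1 = - (T 1 * T 1 * T 1) := by
  rw [← T_add, ← T_add]
  simp [jonesFactor]

theorem jonesFactor_neg_one : jonesFactor (-1) = - (T (-1) * T (-1) * T (-1)) := by
  rw [← T_add, ← T_add]
  simp [jonesFactor]

/-- The relations hold for the values that lead to the Jones polynomial. -/
theorem jonesValue_rel {x y : MvPolynomial SkeinGen ℤ} (h : SkeinGen.Rel x y) :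
    MvPolynomial.eval₂Hom (Int.castRingHom _) jonesValue x =
      MvPolynomial.eval₂Hom (Int.castRingHom _) jonesValue y := by
  have h1 := T_one_mul_T_neg_one
  have h2 : (T 2 : LaurentPolynomial ℤ) = T 1 * T 1 := by rw [← T_add]; rfl
  have h2' : (T (-2) : LaurentPolynomial ℤ) = T (-1) * T (-1) := by rw [← T_add]; rfl
  have hv (n : ℕ+) : (n + 1).natPred = n.natPred + 1 := by
    rw [PNat.natPred_add_one]; rfl
  cases h <;> simp only [map_mul, map_add, map_one, MvPolynomial.coe_eval₂Hom, MvPolynomial.eval₂_X,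
    jonesValue, hv, pow_succ, sub_eq_add_neg _ (1 : ℤ), jonesFactor_add, jonesFactor_one,
    jonesFactor_neg_one, h2, h2']
  case g_mul_h w c μ => rw [← jonesFactor_add, add_neg_cancel, jonesFactor_zero]
  all_goals
    generalize (T 1 : LaurentPolynomial ℤ) = x at *
    generalize (T (-1) : LaurentPolynomial ℤ) = y at *
  case reidemeisterI_pos w c μ n =>
    linear_combination jonesFactor w * (-(x * x) - y * y) ^ n.natPred *
      (x ^ 4 + x ^ 2 * y ^ 2 + x * y + 1) * h1
  case reidemeisterI_neg w c μ n =>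
    linear_combination jonesFactor w * (-(x * x) - y * y) ^ n.natPred *
      (y ^ 4 + x ^ 2 * y ^ 2 + x * y + 1) * h1
  case reidemeisterII w c μ n =>
    linear_combination jonesFactor w * (-(x * x) - y * y) ^ n.natPred *
      (2 * (-(x * x) - y * y)) * h1

/-- The ring homomorphism that turns the invariant into the Jones polynomial. -/
noncomputable def jonesHom : SkeinRing →+* LaurentPolynomial ℤ :=
  RingQuot.lift ⟨MvPolynomial.eval₂Hom (Int.castRingHom _) jonesValue, fun _ _ h => jonesValue_rel h⟩

theorem jonesHom_gen (x : SkeinGen) : jonesHom (gen x) = jonesValue x := by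
  unfold jonesHom SkeinRing.gen
  rw [RingQuot.lift_mkRingHom_apply, MvPolynomial.coe_eval₂Hom, MvPolynomial.eval₂_X]

theorem jonesHom_normalised (D : OrientedDiagram) :
    jonesHom (normalised skeinBracket D) =
      jonesFactor D.writhe * jonesHom (skeinBracket D.toLinkDiagram) := by
  rw [normalised, map_mul, jonesHom_gen, jonesValue]

open LocalPicture in
/-- The state sums of the diagrams of a skein triple involve only two numbers: that of the smoothing
that respects the orientation, and that of the other smoothing. -/
theorem Placement.exists_bracket_eq {R : Type*} [CommRing R] (A B : R) (v : ℕ → R)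
    {L L' L₀ : SurfaceDiagram} {X M : Type} {a : Placement L LocalPicture.crossing X M}
    {b : Placement L' switched X M} {c : Placement L₀ smoothI X M} (hab : a.SameOutside b)
    (hac : a.SameOutside c) :
    ∃ y, L.bracket A B v = A * L₀.bracket A B v + B * y ∧
      L'.bracket A B v = A * y + B * L₀.bracket A B v := by
  have := a.finite_outside.1
  rw [a.bracket_eq A B v isRegular_crossing, b.bracket_eq A B v isRegular_switched,
    c.bracket_eq A B v isRegular_smoothI, ← hab.portEdge_eq isRegular_crossing.1 isRegular_switched.1,
    ← hac.portEdge_eq isRegular_crossing.1 isRegular_smoothI.1]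
  refine ⟨stateSum A B X fun s => v (loopCount (a.portEdge isRegular_crossing.1)
    (Sum.map (Dart.smooth s) ![1, 0, 3, 2]) + 0), ?_, ?_⟩ <;>
  simp only [mul_stateSum, ← stateSum_add, LocalPicture.bracket_crossing,
    LocalPicture.bracket_switched, LocalPicture.bracket_smoothI]

open LocalPicture in
/-- The orientation of the smoothing forces the crossing to be positive and the switched crossing to
be negative. -/
theorem Placement.writhe_skein {L L' L₀ : OrientedDiagram} {X M : Type}
    {a : Placement L.toSurfaceDiagram LocalPicture.crossing X M}
    {b : Placement L'.toSurfaceDiagram switched X M}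
    {c : Placement L₀.toSurfaceDiagram smoothI X M} (hab : ∀ u, L.out (a.port u) = L'.out (b.port u))
    (hac : ∀ u, L.out (a.port u) = L₀.out (c.port u)) :
    L.writhe = L₀.writhe + 1 ∧ L'.writhe = L₀.writhe + -1 := by
  have h1 := c.writhe_sub_eq a fun u => (hac u).symm
  have h2 := c.writhe_sub_eq b fun u => (hac u).symm.trans (hab u)
  have e0 : ∑ y : smoothI.Crossing, L₀.sign (c.crossing (.inr y)) = 0 := rfl
  have e1 : ∑ y : LocalPicture.crossing.Crossing, L.sign (a.crossing (.inr y)) =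
    L.sign (a.crossing (.inr ())) + 0 := rfl
  have e2 : ∑ y : switched.Crossing, L'.sign (b.crossing (.inr y)) =
    L'.sign (b.crossing (.inr ())) + 0 := rfl
  have ho : L₀.out (c.port (.inr 2)) = !L₀.out (c.port (.inr 1)) := L₀.out_opp (c.port (.inr 1))
  rw [← hac, ← hac] at ho
  have ho' := ho
  rw [hab, hab] at ho'
  have s1 : L.sign (a.crossing (.inr ())) = 1 := by
    have h : L.out (a.port (.inr 2)) = !L.out (a.port (.inr 0)) := L.out_opp (a.port (.inr 0))
    rw [h, Bool.not_inj_iff] at ho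
    exact if_pos ho
  have s2 : L'.sign (b.crossing (.inr ())) = -1 := by
    refine if_neg ?_
    change ¬ L'.out (b.port (.inr 1)) = L'.out (b.port (.inr 2))
    rw [ho']
    simp
  rw [e0, e1, s1] at h1
  rw [e0, e2, s2] at h2
  constructor <;> omega

theorem isJonesPolynomial_jonesHom :
    IsJonesPolynomial fun D => jonesHom (normalised skeinBracket D) := by
  refine ⟨fun D D' h => congrArg jonesHom (isLinkInvariant_normalised_skeinBracket D D' h),
    fun D hc hn => ?_, fun L L' L₀ X M A B C hAB hAC hout hout' => ?_⟩
  · have : IsEmpty D.Crossing :=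
      (Nat.card_eq_zero.1 hc).resolve_right fun h => h.not_finite inferInstance
    have hw : D.writhe = 0 := finsum_of_isEmpty _
    simp only [jonesHom_normalised, hw, jonesFactor_zero, one_mul]
    rw [takesTrivialValues_skeinBracket D.toLinkDiagram 1 hc hn, jonesHom_gen]
    rfl
  · obtain ⟨y, hL, hL'⟩ := Placement.exists_bracket_eq (gen a) (gen b) loopValue hAB hAC
    obtain ⟨hw, hw'⟩ := Placement.writhe_skein hout hout'
    replace hL := congrArg jonesHom hL
    replace hL' := congrArg jonesHom hL'
    simp only [map_add, map_mul, jonesHom_gen, jonesValue] at hL hL'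
    simp only [jonesHom_normalised, skeinBracket, hw, hw', jonesFactor_add, jonesFactor_one,
      jonesFactor_neg_one, hL, hL']
    have h1 := T_one_mul_T_neg_one
    have h2 : (T 2 : LaurentPolynomial ℤ) = T 1 * T 1 := by rw [← T_add]; rfl
    have h2' : (T (-2) : LaurentPolynomial ℤ) = T (-1) * T (-1) := by rw [← T_add]; rfl
    have h4 : (T 4 : LaurentPolynomial ℤ) = T 1 * T 1 * (T 1 * T 1) := by
      rw [← T_add, ← T_add]; rfl
    have h4' : (T (-4) : LaurentPolynomial ℤ) = T (-1) * T (-1) * (T (-1) * T (-1)) := by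
      rw [← T_add, ← T_add]; rfl
    rw [h2, h2', h4, h4']
    generalize (T 1 : LaurentPolynomial ℤ) = x at *
    generalize (T (-1) : LaurentPolynomial ℤ) = z at *
    linear_combination jonesFactor L₀.writhe * jonesHom (L₀.bracket (gen a) (gen b) loopValue) *
      (x * x - z * z) * (x ^ 2 * z ^ 2 + x * z + 1) * h1

open SkeinGen SkeinRing LaurentPolynomial in
theorem mainTheorem4 :
    ∃ f : LinkDiagram → SkeinRing,
      IsDiagramInvariant f ∧ SatisfiesSkeinRelations f ∧ TakesTrivialValues f ∧
      (∀ f' : LinkDiagram → SkeinRing,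
        SatisfiesSkeinRelations f' → TakesTrivialValues f' → f' = f) ∧
      IsLinkInvariant (normalised f) ∧
      ∃ φ : SkeinRing →+* LaurentPolynomial ℤ,
        φ (gen a) = T (-1) ∧ φ (gen a') = T (-1) ∧ φ (gen b) = T 1 ∧ φ (gen b') = T 1 ∧
        (∀ (w : ℤ) (c μ : ℕ), φ (gen (g w c μ)) = ((w.negOnePow : ℤˣ) : ℤ) • T (3 * w)) ∧
        IsJonesPolynomial (fun D => φ (normalised f D)) :=
  ⟨skeinBracket, isDiagramInvariant_skeinBracket, satisfiesSkeinRelations_skeinBracket,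
    takesTrivialValues_skeinBracket,
    fun _ hf hv => hf.eq_of_takesTrivialValues satisfiesSkeinRelations_skeinBracket hv
      takesTrivialValues_skeinBracket,
    isLinkInvariant_normalised_skeinBracket, jonesHom, jonesHom_gen _, jonesHom_gen _,
    jonesHom_gen _, jonesHom_gen _, fun _ _ _ => jonesHom_gen _, isJonesPolynomial_jonesHom⟩
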